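/- Let $n\ge 1$ and let $q,p_1,\dots,p_{n-1}$ be positive integers with $p_i<q$ and $\gcd(p_i,q)=1$ for $1\le i\le n-1$; put $p_n=-1$. Let $B_k$ and $B_k(x)$ be the Bernoulli numbers and polynomials, $\frac{ze^{xz}}{e^z-1}=\sum_{k\ge0}\frac{B_k(x)}{k!}z^k$, $B_k=B_k(0)$, and let $\langle t\rangle=t-\lfloor t\rfloor$. For $\mathbf m\in\mathbb Z_{\ge0}^n$ write $|\mathbf m|=\sum_i m_i$, $\mathbf m!=\prod_i m_i!$, $B_{\mathbf m}=\prod_i B_{m_i}$. For $\mathbf r=(r_1,\dots,r_n)\in\mathbb Z_{\ge1}^n$ define the Todd coefficient $$t_{\mathbf r}=t_{\mathbf r}(q;p_1,\dots,p_{n-1})=\sum_{k_1,\dots,k_{n-1}=0}^{q-1}B_{r_1}\!\left(\tfrac{k_1}{q}\right)\cdots B_{r_{n-1}}\!\left(\tfrac{k_{n-1}}{q}\right)B_{r_n}\!\left(\left\langle\tfrac{p_1k_1+\cdots+p_{n-1}k_{n-1}}{q}\right\rangle\right).$$ Let $N=|\mathbf r|$ and let $d=d_{N,n}$ be the least common multiple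 of the denominators of the coefficients of the Todd polynomial $\mathrm{Todd}^N(x_1,\dots,x_n)=(-1)^N\sum_{|\mathbf m|=N}\frac{B_{\mathbf m}}{\mathbf m!}x_1^{m_1}\cdots x_n^{m_n}$ (the degree-$N$ part of $\prod_i\frac{x_i}{1-e^{-x_i}}$), so that $dB_{\mathbf m}/\mathbf m!\in\mathbb Z$ whenever $|\mathbf m|=N$. Then $\dfrac{d\,q^{N-n+1}}{\mathbf r!}\,t_{\mathbf r}$ is an integer, and $$\frac{d\,q^{N-n+1}}{\mathbf r!}\,t_{\mathbf r}\;\equiv\;\sum_{\mathbf m}(-d)\,\frac{B_{\mathbf m}}{\mathbf m!}\prod_{i=1}^n\binom{m_i-1}{r_i-1}p_i^{\,m_i-r_i}\pmod q,$$ where the sum is over all $\mathbf m\in\mathbb Z_{\ge0}^n$ with $|\mathbf m|=N$ and at least one coordinate equal to $0$. Here $\binom{a}{b}=\frac{a(a-1)\cdots(a-b+1)}{b!}$ is the generalized binomial coefficient (so $\binom{-1}{b}=(-1)^b$), and negative powers of $p_i$ denote powers of an inverse of $p_i$ modulo $q$. -/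

import Mathlib

open scoped Nat

namespace ToddCongruence

/-- `B_m / m! = ∏ᵢ B_{mᵢ} / mᵢ!` for a multi-index `m`, with the convention `B₁ = -1/2`. -/
noncomputable def bernoulliQuot {n : ℕ} (m : Fin n → ℕ) : ℚ :=
  ∏ i, bernoulli (m i) / ((m i)! : ℚ)

/-- The `N`-th Todd polynomial in `n` variables,
`Todd^N(x₁, …, xₙ) = (-1)^N ∑_{|m| = N} (B_m / m!) x^m`, i.e. the homogeneous part of
degree `N` of `∏ᵢ xᵢ / (1 - e^{-xᵢ})`. -/
noncomputable def toddPolynomial (N n : ℕ) : MvPolynomial (Fin n) ℚ :=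
  (-1) ^ N * ∑ m ∈ Finset.piAntidiag (Finset.univ : Finset (Fin n)) N,
    MvPolynomial.monomial (Finsupp.equivFunOnFinite.symm m) (bernoulliQuot m)

/-- `d_{N,n}`: the least common multiple of the denominators of the coefficients of the
`N`-th Todd polynomial in `n` variables. -/
noncomputable def toddDenom (N n : ℕ) : ℕ :=
  (toddPolynomial N n).support.lcm fun e => (MvPolynomial.coeff e (toddPolynomial N n)).den

/-- The Todd coefficient `t_j(q; p₁, …, p_{n-1})`, where `n = k + 1`. -/
noncomputable def toddCoeff {k : ℕ} (q : ℕ) (p : Fin k → ℕ) (j : Fin (k + 1) → ℕ) : ℚ :=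
  ∑ a : Fin k → Fin q,
    (∏ i : Fin k, (Polynomial.bernoulli (j i.castSucc)).eval ((a i : ℚ) / (q : ℚ))) *
      (Polynomial.bernoulli (j (Fin.last k))).eval
        (Int.fract ((∑ i : Fin k, (p i : ℚ) * (a i : ℚ)) / (q : ℚ)))

/-- The integer `d_{N,n} B_m / m!` with `N = |m|` (see `cast_scaledBernoulli`). -/
noncomputable def scaledBernoulli {n : ℕ} (m : Fin n → ℕ) : ℤ :=
  ((toddDenom (∑ i, m i) n : ℚ) * bernoulliQuot m).num

/-- The residue classes of `p₁, …, p_{n-1}` and of `pₙ = -1`, as units modulo `q`. -/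
def unitsOf {k : ℕ} (q : ℕ) (p : Fin k → ℕ) (hp : ∀ i, (p i).Coprime q) :
    Fin (k + 1) → (ZMod q)ˣ :=
  Fin.snoc (α := fun _ => (ZMod q)ˣ) (fun i => ZMod.unitOfCoprime (p i) (hp i)) (-1)

theorem coeff_toddPolynomial {n : ℕ} (m : Fin n → ℕ) :
    MvPolynomial.coeff (Finsupp.equivFunOnFinite.symm m) (toddPolynomial (∑ i, m i) n) =
      (-1) ^ (∑ i, m i) * bernoulliQuot m := by
  classical
  have h : ((-1 : MvPolynomial (Fin n) ℚ)) ^ (∑ i, m i) =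
      MvPolynomial.C ((-1) ^ (∑ i, m i)) := by simp
  rw [toddPolynomial, h, MvPolynomial.coeff_C_mul, MvPolynomial.coeff_sum]
  simp only [MvPolynomial.coeff_monomial, EmbeddingLike.apply_eq_iff_eq]
  rw [Finset.sum_ite_eq']
  simp

theorem cast_scaledBernoulli {n : ℕ} (m : Fin n → ℕ) :
    (scaledBernoulli m : ℚ) = (toddDenom (∑ i, m i) n : ℚ) * bernoulliQuot m := by
  have key : (bernoulliQuot m).den ∣ toddDenom (∑ i, m i) n := by
    by_cases h0 : bernoulliQuot m = 0
    · simp [h0]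
    have hc := coeff_toddPolynomial m
    have hs : Finsupp.equivFunOnFinite.symm m ∈ (toddPolynomial (∑ i, m i) n).support := by
      rw [MvPolynomial.mem_support_iff, hc]
      exact mul_ne_zero (pow_ne_zero _ (by norm_num)) h0
    have hd := Finset.dvd_lcm
      (f := fun e => (MvPolynomial.coeff e (toddPolynomial (∑ i, m i) n)).den) hs
    have e : (MvPolynomial.coeff (Finsupp.equivFunOnFinite.symm m)
        (toddPolynomial (∑ i, m i) n)).den = (bernoulliQuot m).den := by
      rw [hc]
      rcases neg_one_pow_eq_or ℚ (∑ i, m i) with h | h <;> rw [h] <;> simp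
    simp only [e] at hd
    exact hd
  obtain ⟨c, hc⟩ := key
  have e : (toddDenom (∑ i, m i) n : ℚ) * bernoulliQuot m =
      (((c : ℤ) * (bernoulliQuot m).num : ℤ) : ℚ) := by
    rw [hc]
    push_cast
    have := Rat.den_mul_eq_num (bernoulliQuot m)
    rw [← this]
    ring
  rw [scaledBernoulli, e, Rat.num_intCast]

end ToddCongruence

/-! Put `n = k + 1` and `P = (p₁, …, pₖ, q - 1)`. The points `b` of `[0, q)ⁿ` with `q ∣ P·b` form
the graph of `bₙ ≡ ∑ pᵢ bᵢ`, so the Todd coefficient is a sum of products of Bernoulli polynomials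
over this box (`boxSum_snoc`). The box belongs to the monoid of all `x ∈ ℕⁿ` with `q ∣ P·x`;
adjoining `x₀ = P·x / q` makes it the monoid of vectors of weight zero in `ℕⁿ⁺¹`. Its generating
function `F` is evaluated at `Xᵢ = e^{λᵢ u}` in two ways.

Using the edges of the cone, `F` is the box polynomial over a product of `n` factors `1 - X^edge`,
and `uⁿ F` expands in the values `B_m(bᵢ / q)` (`realizes_indicator_weight`,
`coeff_coeff_boxSeries`). Using Elliott's reduction, `F` is a `ℤ`-combination of products of at most
`n` factors `1 / (1 - X^v)`, the `v` being part of a unimodular family of weight zero. Then `uⁿ F`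
involves only `B_m / m!` times integral quantities, and `d` clears the denominators at `u^N`
(`toddDenom_smul_coeff_mem`).

The exponents are `λ₀ = 0` and `λᵢ = Pᵢ / q + Tⁱ + Yᵢ`, with `T` an indeterminate over `ℤ` and `Yᵢ`
formal variables. For `v` of weight zero the fractions `Pᵢ / q` add up to the integer `v₀`, so the
constant term of `∑ vᵢ λᵢ` is `∑ v_l T^l`, a primitive polynomial. It is a unit of the ring `R` of
fractions with primitive denominator, and `R ∩ ℚ = ℤ`, `ℤ ∩ qR = qℤ` by Gauss's lemma.

Now take the coefficient of `u^N Y^{r-1}` and multiply it by `±dq`. The index `m = r` gives the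
scaled Todd coefficient; every other `m` without a zero coordinate has a vanishing binomial; if `m`
has a zero coordinate, the multiplication theorem turns the box sum into `B_m` and all powers of `q`
cancel (`q_mul_coeff_boxSeries`). Hence the scaled Todd coefficient is `q w - S` with `w ∈ R`, where
`S` is the sum over the latter `m`. It is an integer, and as `P + qT ≡ P` modulo `qR`, it has the
stated residue. -/

namespace ToddCongruence

/-! ### Elliott's reduction for abstract factors -/

section Elliott

variable {ι V S : Type*} [DecidableEq ι] [AddCommMonoid V] [CommRing S]

/-- One reduction step of Elliott's algorithm on a product of factors. -/
theorem prod_elliott_step (γ : V → S) (v : ι → V) (J : Finset ι) {i j : ι} (hi : i ∈ J)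
    (hj : j ∈ J) (hij : i ≠ j)
    (h : γ (v i) * γ (v j) = γ (v i + v j) * (γ (v i) + γ (v j) - 1)) :
    ∏ l ∈ J, γ (v l) = ∏ l ∈ J, γ (Function.update v i (v i + v j) l) +
      ∏ l ∈ J, γ (Function.update v j (v i + v j) l) -
      ∏ l ∈ J.erase j, γ (Function.update v i (v i + v j) l) := by
  have hj' : j ∈ J.erase i := Finset.mem_erase.2 ⟨hij.symm, hj⟩
  have hi' : i ∈ J.erase j := Finset.mem_erase.2 ⟨hij, hi⟩
  have split : ∀ w : ι → V, ∏ l ∈ J, γ (w l) =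
      γ (w i) * (γ (w j) * ∏ l ∈ (J.erase i).erase j, γ (w l)) := fun w => by
    rw [Finset.mul_prod_erase _ (fun l => γ (w l)) hj',
      Finset.mul_prod_erase _ (fun l => γ (w l)) hi]
  have split' : ∀ w : ι → V, ∏ l ∈ J.erase j, γ (w l) =
      γ (w i) * ∏ l ∈ (J.erase i).erase j, γ (w l) := fun w => by
    rw [Finset.erase_right_comm, Finset.mul_prod_erase _ (fun l => γ (w l)) hi']
  have rest : ∀ (a : ι) (x : V), (a = i ∨ a = j) →
      ∏ l ∈ (J.erase i).erase j, γ (Function.update v a x l) =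
        ∏ l ∈ (J.erase i).erase j, γ (v l) := by
    intro a x ha
    refine Finset.prod_congr rfl fun l hl => ?_
    rw [Function.update_of_ne]
    rintro rfl
    rcases ha with rfl | rfl <;> simp at hl
  rw [split v, split (Function.update v i _), split (Function.update v j _), split',
    rest i _ (Or.inl rfl), rest j _ (Or.inr rfl)]
  simp only [Function.update_self, Function.update_of_ne hij, Function.update_of_ne hij.symm]
  rw [← mul_assoc, h]
  ring

/-- If products all of whose weights lie in `[-B, A]` are good, so are those with weights in
`[-B, A + 1]`, provided `B ≤ A + 1`. -/
theorem prod_mem_of_weight_le_succ (γ : V → S) (wt : V →+ ℤ) (Inv : (ι → V) → Prop)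
    (hInv : ∀ v i j, i ≠ j → Inv v → Inv (Function.update v i (v i + v j)))
    (hγ : ∀ v i j, i ≠ j → Inv v →
      γ (v i) * γ (v j) = γ (v i + v j) * (γ (v i) + γ (v j) - 1))
    (H : AddSubgroup S)
    (hpos : ∀ v (J : Finset ι), Inv v → (∀ i ∈ J, 0 ≤ wt (v i)) → ∏ i ∈ J, γ (v i) ∈ H)
    (A B : ℕ) (hAB : B ≤ A + 1)
    (IH : ∀ v (J : Finset ι), Inv v → (∀ i ∈ J, -(B : ℤ) ≤ wt (v i) ∧ wt (v i) ≤ A) →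
      ∏ i ∈ J, γ (v i) ∈ H) (c : ℕ) :
    ∀ v (J : Finset ι), Inv v → (∀ i ∈ J, -(B : ℤ) ≤ wt (v i) ∧ wt (v i) ≤ A + 1) →
      (J.filter fun i => wt (v i) = A + 1).card + (J.filter fun i => wt (v i) < 0).card ≤ c →
      ∏ i ∈ J, γ (v i) ∈ H := by
  induction c with
  | zero =>
    intro v J hv hJ hc
    have h0 : (J.filter fun i => wt (v i) < 0) = ∅ := by
      rw [← Finset.card_eq_zero]; omega
    refine hpos v J hv fun i hi => ?_
    by_contra hneg
    have : i ∈ (J.filter fun i => wt (v i) < 0) := by simp [hi]; omega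
    simp [h0] at this
  | succ c ih =>
    intro v J hv hJ hc
    by_cases h1 : ∃ i ∈ J, wt (v i) = A + 1
    swap
    · push Not at h1
      refine IH v J hv fun i hi => ⟨(hJ i hi).1, ?_⟩
      have := h1 i hi
      have := (hJ i hi).2
      omega
    by_cases h2 : ∃ j ∈ J, wt (v j) < 0
    swap
    · push Not at h2
      exact hpos v J hv h2
    obtain ⟨i, hi, hwi⟩ := h1
    obtain ⟨j, hj, hwj⟩ := h2
    have hij : i ≠ j := by rintro rfl; omega
    have hBj := (hJ j hj).1
    -- As `-B ≤ wt (v j) < 0` and `B ≤ A + 1`, this weight lies in `[0, A]`: the new vector is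
    -- neither of top weight nor negative, so in each of the three products the count of bad vectors
    -- drops.
    have wi : wt (v i + v j) = A + 1 + wt (v j) := by rw [map_add, hwi]
    have key : ∀ a ∈ J, ((a = i) ∨ (a = j)) → ∀ K ⊆ J,
        (Inv (Function.update v a (v i + v j))) →
        ∏ l ∈ K, γ (Function.update v a (v i + v j) l) ∈ H := by
      intro a ha haij K hK hva
      have hle : ∀ l, l ≠ a → wt (Function.update v a (v i + v j) l) = wt (v l) := fun l hl => by
        rw [Function.update_of_ne hl]
      refine ih _ K hva (fun l hl => ?_) ?_
      · by_cases h : l = a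
        · subst h; rw [Function.update_self, wi]; omega
        · rw [hle l h]; exact hJ l (hK hl)
      · have s1 : (K.filter fun l => wt (Function.update v a (v i + v j) l) = A + 1) ⊆
            (J.filter fun l => wt (v l) = A + 1).erase a := by
          intro l hl
          rw [Finset.mem_filter] at hl
          by_cases h : l = a
          · subst h; rw [Function.update_self, wi] at hl; omega
          · rw [hle l h] at hl; simp [h, hK hl.1, hl.2]
        have s2 : (K.filter fun l => wt (Function.update v a (v i + v j) l) < 0) ⊆
            (J.filter fun l => wt (v l) < 0).erase a := by
          intro l hl
          rw [Finset.mem_filter] at hl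
          by_cases h : l = a
          · subst h; rw [Function.update_self, wi] at hl; omega
          · rw [hle l h] at hl; simp [h, hK hl.1, hl.2]
        have c1 := Finset.card_le_card s1
        have c2 := Finset.card_le_card s2
        rcases haij with rfl | rfl
        · have := Finset.card_erase_lt_of_mem
            (show a ∈ J.filter fun l => wt (v l) = A + 1 by simp [ha, hwi])
          have := Finset.card_erase_le (s := J.filter fun l => wt (v l) < 0) (a := a)
          omega
        · have := Finset.card_erase_lt_of_mem
            (show a ∈ J.filter fun l => wt (v l) < 0 by simp [ha, hwj])
          have := Finset.card_erase_le (s := J.filter fun l => wt (v l) = A + 1) (a := a)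
          omega
    have v1 := hInv v i j hij hv
    have v2 := hInv v j i hij.symm hv
    rw [add_comm (v j)] at v2
    rw [prod_elliott_step γ v J hi hj hij (hγ v i j hij hv)]
    exact H.sub_mem (H.add_mem (key i hi (Or.inl rfl) J subset_rfl v1)
      (key j hj (Or.inr rfl) J subset_rfl v2))
      (key i hi (Or.inl rfl) _ (Finset.erase_subset _ _) v1)

/-- Elliott's reduction: a product of factors `γ (v i)` is a `ℤ`-combination of such products whose
weights all have the same sign. -/
theorem prod_mem_of_same_sign (γ : V → S) (wt : V →+ ℤ) (Inv : (ι → V) → Prop)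
    (hInv : ∀ v i j, i ≠ j → Inv v → Inv (Function.update v i (v i + v j)))
    (hγ : ∀ v i j, i ≠ j → Inv v →
      γ (v i) * γ (v j) = γ (v i + v j) * (γ (v i) + γ (v j) - 1))
    (H : AddSubgroup S)
    (hpos : ∀ v (J : Finset ι), Inv v → (∀ i ∈ J, 0 ≤ wt (v i)) → ∏ i ∈ J, γ (v i) ∈ H)
    (hneg : ∀ v (J : Finset ι), Inv v → (∀ i ∈ J, wt (v i) ≤ 0) → ∏ i ∈ J, γ (v i) ∈ H)
    (v : ι → V) (J : Finset ι) (hv : Inv v) : ∏ i ∈ J, γ (v i) ∈ H := by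
  -- Induction on the width of the interval of weights, shrinking its longer side; the lower side is
  -- handled by passing to `-wt`.
  have main : ∀ n A B : ℕ, A + B = n → ∀ v (J : Finset ι), Inv v →
      (∀ i ∈ J, -(B : ℤ) ≤ wt (v i) ∧ wt (v i) ≤ A) → ∏ i ∈ J, γ (v i) ∈ H := by
    intro n
    induction n with
    | zero =>
      intro A B hAB v J hv hJ
      refine hneg v J hv fun i hi => ?_
      have := (hJ i hi).2
      omega
    | succ n ih =>
      intro A B hAB v J hv hJ
      by_cases h : B ≤ A
      · obtain ⟨A, rfl⟩ : ∃ A', A = A' + 1 := ⟨A - 1, by omega⟩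
        exact prod_mem_of_weight_le_succ γ wt Inv hInv hγ H hpos A B h
          (ih A B (by omega)) _ v J hv (by simpa using hJ) le_rfl
      · obtain ⟨B, rfl⟩ : ∃ B', B = B' + 1 := ⟨B - 1, by omega⟩
        refine prod_mem_of_weight_le_succ γ (-wt) Inv hInv hγ H
          (fun v J hv hJ => hneg v J hv fun i hi => by simpa using hJ i hi) B A (by omega)
          (fun v J hv hJ => ih A B (by omega) v J hv fun i hi => ?_) _ v J hv (fun i hi => ?_) le_rfl
        · have := hJ i hi
          simp only [AddMonoidHom.neg_apply] at this
          omega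
        · have := hJ i hi
          simp only [AddMonoidHom.neg_apply]
          push_cast at this
          omega
  refine main _ (∑ i ∈ J, (wt (v i)).natAbs) (∑ i ∈ J, (wt (v i)).natAbs) rfl v J hv fun i hi => ?_
  have := Finset.single_le_sum (f := fun i => (wt (v i)).natAbs) (fun _ _ => Nat.zero_le _) hi
  omega

end Elliott

/-! ### Geometric series, weight zero parts and unimodular families -/

section PowerSeries

open MvPowerSeries

variable {ι : Type*}

/-- The geometric series `1 / (1 - X^v)`. -/
noncomputable def geom (v : ι →₀ ℕ) : MvPowerSeries ι ℚ := (1 - monomial v 1)⁻¹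

theorem one_sub_mul_geom {v : ι →₀ ℕ} (hv : v ≠ 0) : (1 - monomial v (1 : ℚ)) * geom v = 1 := by
  classical
  refine MvPowerSeries.mul_inv_cancel _ ?_
  rw [← coeff_zero_eq_constantCoeff_apply, map_sub, coeff_monomial, if_neg hv.symm]
  simp

/-- Divide `1 - AB = (1 - A) + (1 - B) - (1 - A)(1 - B)` by `(1 - A)(1 - B)(1 - AB)`. -/
theorem geom_mul_geom {a b : ι →₀ ℕ} (ha : a ≠ 0) (hb : b ≠ 0) :
    geom a * geom b = geom (a + b) * (geom a + geom b - 1) := by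
  have hab : a + b ≠ 0 := by
    intro h
    exact ha (by simpa using (add_eq_zero.1 h).1)
  have h1 := one_sub_mul_geom ha
  have h2 := one_sub_mul_geom hb
  have h3 := one_sub_mul_geom hab
  rw [show monomial (a + b) (1 : ℚ) = monomial a 1 * monomial b 1 by
    rw [monomial_mul_monomial, mul_one]] at h3
  generalize geom (a + b) = G at *
  generalize geom a = Ga at *
  generalize geom b = Gb at *
  generalize monomial a (1 : ℚ) = A at *
  generalize monomial b (1 : ℚ) = B at *
  have e : Ga * Gb * (1 - A * B) = Ga + Gb - 1 := by
    linear_combination (B * Gb) * h1 + (Ga - 1) * h2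
  rw [← e]
  linear_combination (-(Ga * Gb)) * h3

theorem exists_nsmul_of_coeff_geom_ne_zero {v : ι →₀ ℕ} (hv : v ≠ 0) :
    ∀ (n : ℕ) (e : ι →₀ ℕ), e.degree = n → coeff e (geom v) ≠ 0 → ∃ c : ℕ, e = c • v := by
  classical
  intro n
  induction n using Nat.strong_induction_on with
  | _ n ih =>
    intro e hn he
    have h : geom v = 1 + monomial v 1 * geom v := by
      linear_combination one_sub_mul_geom hv
    rw [h, map_add, coeff_one, coeff_monomial_mul] at he
    by_cases h0 : e = 0
    · exact ⟨0, by simp [h0]⟩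
    rw [if_neg h0, zero_add] at he
    by_cases hle : v ≤ e
    · rw [if_pos hle, one_mul] at he
      obtain ⟨d, rfl⟩ := exists_add_of_le hle
      rw [add_tsub_cancel_left] at he
      have hd : v.degree ≠ 0 := by simpa [Finsupp.degree_eq_zero_iff] using hv
      obtain ⟨c, hc⟩ := ih d.degree (by rw [← hn, map_add]; omega) d rfl he
      exact ⟨c + 1, by rw [hc, add_smul, one_smul, add_comm]⟩
    · simp [hle] at he

/-- The part of a power series supported on the exponents of weight zero. -/
noncomputable def weightZero (wt : (ι →₀ ℕ) →+ ℤ) :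
    MvPowerSeries ι ℚ →+ MvPowerSeries ι ℚ where
  toFun s := fun e => if wt e = 0 then coeff e s else 0
  map_zero' := funext fun e => by
    rw [map_zero, ite_self]
    rfl
  map_add' s t := funext fun e => by
    change _ = (if wt e = 0 then coeff e s else 0) + if wt e = 0 then coeff e t else 0
    split_ifs
    · exact map_add _ _ _
    · exact (add_zero 0).symm

theorem coeff_weightZero (wt : (ι →₀ ℕ) →+ ℤ) (s : MvPowerSeries ι ℚ) (e : ι →₀ ℕ) :
    coeff e (weightZero wt s) = if wt e = 0 then coeff e s else 0 := rfl

theorem weightZero_neg (wt : (ι →₀ ℕ) →+ ℤ) (s : MvPowerSeries ι ℚ) :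
    weightZero (-wt) s = weightZero wt s := by
  ext e
  simp [coeff_weightZero]

/-- Two nonnegative weights add up to zero only if both vanish; without the sign condition
multiplicativity fails. -/
theorem weightZero_mul (wt : (ι →₀ ℕ) →+ ℤ) {s t : MvPowerSeries ι ℚ}
    (hs : ∀ e, coeff e s ≠ 0 → 0 ≤ wt e) (ht : ∀ e, coeff e t ≠ 0 → 0 ≤ wt e) :
    weightZero wt (s * t) = weightZero wt s * weightZero wt t := by
  classical
  ext e
  rw [coeff_weightZero, coeff_mul, coeff_mul]
  split_ifs with he
  · refine Finset.sum_congr rfl fun x hx => ?_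
    rw [Finset.HasAntidiagonal.mem_antidiagonal] at hx
    rw [← hx, map_add] at he
    rw [coeff_weightZero, coeff_weightZero]
    by_cases h1 : coeff x.1 s = 0
    · simp [h1]
    by_cases h2 : coeff x.2 t = 0
    · simp [h2]
    have := hs _ h1
    have := ht _ h2
    rw [if_pos (by omega), if_pos (by omega)]
  · symm
    refine Finset.sum_eq_zero fun x hx => ?_
    rw [Finset.HasAntidiagonal.mem_antidiagonal] at hx
    rw [← hx, map_add] at he
    rw [coeff_weightZero, coeff_weightZero]
    by_cases h1 : wt x.1 = 0
    · rw [if_neg (c := wt x.2 = 0) (by omega), mul_zero]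
    · rw [if_neg h1, zero_mul]

theorem coeff_mul_nonneg_weight (wt : (ι →₀ ℕ) →+ ℤ) {s t : MvPowerSeries ι ℚ}
    (hs : ∀ e, coeff e s ≠ 0 → 0 ≤ wt e) (ht : ∀ e, coeff e t ≠ 0 → 0 ≤ wt e) :
    ∀ e, coeff e (s * t) ≠ 0 → 0 ≤ wt e := by
  classical
  intro e he
  rw [coeff_mul] at he
  obtain ⟨x, hx, hne⟩ := Finset.exists_ne_zero_of_sum_ne_zero he
  rw [Finset.HasAntidiagonal.mem_antidiagonal] at hx
  rw [← hx, map_add]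
  exact add_nonneg (hs _ (left_ne_zero_of_mul hne)) (ht _ (right_ne_zero_of_mul hne))

theorem geom_nonneg_weight (wt : (ι →₀ ℕ) →+ ℤ) {v : ι →₀ ℕ} (hv : v ≠ 0) (h : 0 ≤ wt v) :
    ∀ e, coeff e (geom v) ≠ 0 → 0 ≤ wt e := by
  intro e he
  obtain ⟨c, rfl⟩ := exists_nsmul_of_coeff_geom_ne_zero hv _ e rfl he
  rw [map_nsmul]
  exact nsmul_nonneg h c

theorem weightZero_one (wt : (ι →₀ ℕ) →+ ℤ) : weightZero wt 1 = 1 := by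
  classical
  ext e
  rw [coeff_weightZero, coeff_one]
  by_cases h : e = 0 <;> simp [h]

theorem weightZero_geom (wt : (ι →₀ ℕ) →+ ℤ) {v : ι →₀ ℕ} (hv : v ≠ 0) (h : 0 ≤ wt v) :
    weightZero wt (geom v) = if wt v = 0 then geom v else 1 := by
  classical
  split_ifs with h0
  · ext e
    rw [coeff_weightZero]
    split_ifs with he
    · rfl
    · by_contra hne
      obtain ⟨c, rfl⟩ := exists_nsmul_of_coeff_geom_ne_zero hv _ e rfl (Ne.symm hne)
      exact he (by rw [map_nsmul, h0, smul_zero])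
  · have hs : ∀ e, coeff e (1 - monomial v (1 : ℚ)) ≠ 0 → 0 ≤ wt e := by
      intro e he
      rw [map_sub, coeff_one, coeff_monomial] at he
      by_cases e0 : e = 0
      · simp [e0]
      by_cases ev : e = v
      · rw [ev]; exact h
      · simp [e0, ev] at he
    have h1 : weightZero wt (1 - monomial v (1 : ℚ)) = 1 := by
      ext e
      rw [coeff_weightZero, map_sub, coeff_one, coeff_monomial]
      by_cases e0 : e = 0
      · simp [e0, hv.symm]
      · by_cases ev : e = v
        · rw [ev, if_neg h0, if_neg hv]
        · simp [e0, ev]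
    -- Taking weight zero parts in `(1 - X^v) · geom v = 1`, where the first factor becomes `1`.
    have := weightZero_mul wt hs (geom_nonneg_weight wt hv h)
    rw [one_sub_mul_geom hv, h1, weightZero_one, one_mul] at this
    exact this.symm

/-- A factor of positive weight contributes only its constant term. This is why Elliott's reduction
aims at weights of one sign. -/
theorem weightZero_prod_geom (wt : (ι →₀ ℕ) →+ ℤ) {κ : Type*} (v : κ → ι →₀ ℕ)
    (hv : ∀ i, v i ≠ 0) (J : Finset κ) (h : ∀ i ∈ J, 0 ≤ wt (v i)) :
    weightZero wt (∏ i ∈ J, geom (v i)) = ∏ i ∈ J.filter fun i => wt (v i) = 0, geom (v i) := by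
  classical
  have key : weightZero wt (∏ i ∈ J, geom (v i)) =
      (∏ i ∈ J, if wt (v i) = 0 then geom (v i) else 1) ∧
      ∀ e, coeff e (∏ i ∈ J, geom (v i)) ≠ 0 → 0 ≤ wt e := by
    induction J using Finset.induction_on with
    | empty =>
      refine ⟨by simpa using weightZero_one wt, fun e he => ?_⟩
      rw [Finset.prod_empty, coeff_one] at he
      by_cases e0 : e = 0
      · simp [e0]
      · simp [e0] at he
    | insert a J ha ih =>
      have ih := ih fun i hi => h i (Finset.mem_insert_of_mem hi)
      have h1 := geom_nonneg_weight wt (hv a) (h a (Finset.mem_insert_self _ _))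
      rw [Finset.prod_insert ha, Finset.prod_insert ha]
      refine ⟨?_, coeff_mul_nonneg_weight wt h1 ih.2⟩
      rw [weightZero_mul wt h1 ih.2, ih.1,
        weightZero_geom wt (hv a) (h a (Finset.mem_insert_self _ _))]
  rw [key.1, Finset.prod_filter]

variable [Fintype ι]

/-- A family of exponent vectors having a dual family of integral functionals. -/
def Unimodular (v : ι → ι →₀ ℕ) : Prop :=
  by classical exact ∃ f : ι → ι → ℤ, ∀ i j, ∑ l, f i l * (v j l : ℤ) = if i = j then 1 else 0

theorem Unimodular.exists_functional {v : ι → ι →₀ ℕ} (h : Unimodular v) (i : ι) :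
    ∃ f : ι → ℤ, ∑ l, f l * (v i l : ℤ) = 1 := by
  obtain ⟨f, hf⟩ := h
  exact ⟨f i, by simpa using hf i i⟩

theorem Unimodular.ne_zero {v : ι → ι →₀ ℕ} (h : Unimodular v) (i : ι) : v i ≠ 0 := by
  obtain ⟨f, hf⟩ := h.exists_functional i
  intro h0
  simp [h0] at hf

theorem unimodular_single [DecidableEq ι] :
    Unimodular fun i : ι => Finsupp.single i 1 := by
  refine ⟨fun i l => if i = l then 1 else 0, fun i j => ?_⟩
  simp [Finsupp.single_apply]

theorem Unimodular.update [DecidableEq ι] {v : ι → ι →₀ ℕ} (h : Unimodular v) {i j : ι}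
    (hij : i ≠ j) : Unimodular (Function.update v i (v i + v j)) := by
  obtain ⟨f, hf⟩ := h
  -- The dual family transforms contragrediently: adding `v j` to `v i` subtracts `f i` from `f j`.
  refine ⟨Function.update f j (f j - f i), fun a b => ?_⟩
  have hf' : ∀ a b, ∑ l, f a l * (v b l : ℤ) = if a = b then 1 else 0 := fun a b => by
    convert hf a b
  have e1 : ∀ g : ι → ℤ, ∑ l, g l * (Function.update v i (v i + v j) b l : ℤ) =
      ∑ l, g l * (v b l : ℤ) + if b = i then ∑ l, g l * (v j l : ℤ) else 0 := by
    intro g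
    by_cases hb : b = i
    · subst hb
      rw [Function.update_self, if_pos rfl, ← Finset.sum_add_distrib]
      exact Finset.sum_congr rfl fun l _ => by rw [Finsupp.add_apply]; push_cast; ring
    · rw [Function.update_of_ne hb, if_neg hb, add_zero]
  rw [e1]
  by_cases ha : a = j
  · subst ha
    simp only [Function.update_self, Pi.sub_apply, sub_mul, Finset.sum_sub_distrib, hf']
    by_cases h1 : b = i
    · subst h1; simp [hij.symm, hij]
    · simp [Ne.symm h1, h1]
  · simp only [Function.update_of_ne ha, hf', if_neg ha]
    simp

/-- Elliott's theorem: the weight zero part of `∏ 1 / (1 - X_i)` is a `ℤ`-combination of products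
of geometric series in part of a unimodular family of vectors of weight zero. -/
theorem weightZero_prod_geom_single_mem [DecidableEq ι] (wt : (ι →₀ ℕ) →+ ℤ) (i₀ : ι)
    (hi₀ : wt (Finsupp.single i₀ 1) ≠ 0) (H : AddSubgroup (MvPowerSeries ι ℚ))
    (hH : ∀ v (J : Finset ι), Unimodular v → J ≠ Finset.univ → (∀ i ∈ J, wt (v i) = 0) →
      ∏ i ∈ J, geom (v i) ∈ H) :
    weightZero wt (∏ i, geom (Finsupp.single i 1)) ∈ H := by
  have hpos : ∀ wt' : (ι →₀ ℕ) →+ ℤ, (∀ e, wt' e = 0 ↔ wt e = 0) → ∀ v (J : Finset ι),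
      (Unimodular v ∧ ∃ i, wt (v i) ≠ 0) → (∀ i ∈ J, 0 ≤ wt' (v i)) →
      weightZero wt' (∏ i ∈ J, geom (v i)) ∈ H := by
    intro wt' hwt v J hv hJ
    rw [weightZero_prod_geom wt' v hv.1.ne_zero J hJ]
    refine hH v _ hv.1 ?_ fun i hi => (hwt _).1 (Finset.mem_filter.1 hi).2
    intro h
    obtain ⟨i, hi⟩ := hv.2
    have := Finset.mem_univ i
    rw [← h, Finset.mem_filter] at this
    exact hi ((hwt _).1 this.2)
  -- The invariant also records a vector of nonzero weight somewhere in the family. It survives each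
  -- step, and it ensures that the factors of weight zero never exhaust the family.
  have := prod_mem_of_same_sign (geom : (ι →₀ ℕ) → _) wt
    (fun v => Unimodular v ∧ ∃ i, wt (v i) ≠ 0) ?_ ?_ (H.comap (weightZero wt)) ?_ ?_
    (fun i => Finsupp.single i 1) Finset.univ ⟨unimodular_single, i₀, hi₀⟩
  · simpa using this
  · rintro v i j hij ⟨h1, l, hl⟩
    refine ⟨h1.update hij, ?_⟩
    by_cases hj : wt (v j) = 0
    · refine ⟨l, ?_⟩
      by_cases hli : l = i
      · subst hli; rwa [Function.update_self, map_add, hj, add_zero]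
      · rwa [Function.update_of_ne hli]
    · exact ⟨j, by rwa [Function.update_of_ne hij.symm]⟩
  · exact fun v i j _ hv => geom_mul_geom (hv.1.ne_zero i) (hv.1.ne_zero j)
  · exact fun v J hv hJ => hpos wt (fun _ => Iff.rfl) v J hv hJ
  · intro v J hv hJ
    have := hpos (-wt) (fun e => by simp) v J hv (fun i hi => by simpa using hJ i hi)
    rwa [weightZero_neg] at this

/-- The generating series of a set of exponents. -/
noncomputable def indicator (D : (ι →₀ ℕ) → Prop) : MvPowerSeries ι ℚ :=
  by classical exact fun e => if D e then 1 else 0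

omit [Fintype ι] in
theorem coeff_indicator (D : (ι →₀ ℕ) → Prop) [DecidablePred D] (e : ι →₀ ℕ) :
    coeff e (indicator D) = if D e then 1 else 0 := by
  simp only [indicator, coeff_apply]
  congr

end PowerSeries

/-! ### Generating series of sets of exponents -/

section Indicator

open MvPowerSeries

variable {ι : Type*}

theorem one_sub_monomial_mul_indicator (v : ι →₀ ℕ) (D E : (ι →₀ ℕ) → Prop)
    (h1 : ∀ e, v ≤ e → D (e - v) → D e) (h2 : ∀ e, E e ↔ D e ∧ ¬(v ≤ e ∧ D (e - v))) :
    (1 - monomial v (1 : ℚ)) * indicator D = indicator E := by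
  classical
  ext e
  rw [sub_mul, one_mul, map_sub, coeff_monomial_mul, coeff_indicator, coeff_indicator,
    coeff_indicator, one_mul]
  have := h1 e
  have := h2 e
  by_cases a : D e <;> by_cases b : v ≤ e <;> by_cases c : D (e - v) <;> simp_all

/-- Each factor removes the translate of `D` by `v i`, which amounts to the cut `e i < m i`. Since
`v i` vanishes at the other indices of `I`, the cuts do not interfere. -/
theorem prod_one_sub_monomial_mul_indicator (v : ι → ι →₀ ℕ) (m : ι → ℕ)
    (D : (ι →₀ ℕ) → Prop) (I : Finset ι) (hD : ∀ i ∈ I, ∀ e, v i ≤ e → D (e - v i) → D e)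
    (hD' : ∀ i ∈ I, ∀ e : ι →₀ ℕ, m i ≤ e i → D e → v i ≤ e ∧ D (e - v i))
    (hv : ∀ i ∈ I, v i i = m i) (hv0 : ∀ i ∈ I, ∀ j ∈ I, j ≠ i → v i j = 0) :
    (∏ i ∈ I, (1 - monomial (v i) (1 : ℚ))) * indicator D =
      indicator fun e => D e ∧ ∀ i ∈ I, e i < m i := by
  classical
  induction I using Finset.induction_on with
  | empty => simp
  | insert a I ha ih =>
    rw [Finset.prod_insert ha, mul_assoc,
      ih (fun i hi => hD i (Finset.mem_insert_of_mem hi))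
        (fun i hi => hD' i (Finset.mem_insert_of_mem hi))
        (fun i hi => hv i (Finset.mem_insert_of_mem hi))
        (fun i hi j hj => hv0 i (Finset.mem_insert_of_mem hi) j (Finset.mem_insert_of_mem hj))]
    have haI := Finset.mem_insert_self a I
    have h0 : ∀ e : ι →₀ ℕ, ∀ j ∈ I, (e - v a) j = e j := fun e j hj => by
      rw [Finsupp.tsub_apply, hv0 a haI j (Finset.mem_insert_of_mem hj)
        (by rintro rfl; exact ha hj), tsub_zero]
    refine one_sub_monomial_mul_indicator _ _ _ (fun e hle he => ⟨hD a haI e hle he.1,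
      fun j hj => by rw [← h0 e j hj]; exact he.2 j hj⟩) fun e => ?_
    constructor
    · rintro ⟨he, hlt⟩
      refine ⟨⟨he, fun j hj => hlt j (Finset.mem_insert_of_mem hj)⟩, fun hcon => ?_⟩
      have := hcon.1 a
      rw [hv a haI] at this
      exact absurd (hlt a haI) (by omega)
    · rintro ⟨⟨he, hlt⟩, hnot⟩
      refine ⟨he, fun j hj => ?_⟩
      rcases Finset.mem_insert.1 hj with rfl | hj
      · by_contra hcon
        obtain ⟨hle, hE⟩ := hD' j haI e (by omega) he
        exact hnot ⟨hle, hE, fun i hi => by rw [h0 e i hi]; exact hlt i hi⟩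
      · exact hlt j hj

theorem prod_geom_single [Fintype ι] [DecidableEq ι] :
    ∏ i : ι, geom (Finsupp.single i 1) = indicator fun _ => True := by
  have h1 : ∏ i : ι, (1 - monomial (Finsupp.single i 1) (1 : ℚ)) * geom (Finsupp.single i 1) =
      1 := Finset.prod_eq_one fun i _ => one_sub_mul_geom (by simp)
  have h2 := prod_one_sub_monomial_mul_indicator (fun i : ι => Finsupp.single i 1) (fun _ => 1)
    (fun _ => True) Finset.univ (fun _ _ _ _ _ => trivial)
    (fun i _ e he _ => ⟨by simpa using he, trivial⟩) (by simp)
    (fun i _ j _ hij => by simp [hij.symm])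
  have h3 : (indicator fun e : ι →₀ ℕ => True ∧ ∀ i ∈ Finset.univ, e i < 1) = 1 := by
    classical
    ext e
    rw [coeff_indicator, coeff_one]
    have : (True ∧ ∀ i ∈ Finset.univ, e i < 1) ↔ e = 0 := by
      simp [Finsupp.ext_iff]
    simp only [this]
  rw [h3] at h2
  rw [Finset.prod_mul_distrib] at h1
  rw [← mul_one (∏ i : ι, geom _), ← h2, ← mul_assoc, mul_comm (∏ i : ι, geom _), h1, one_mul]

theorem weightZero_prod_geom_single [Fintype ι] [DecidableEq ι] (wt : (ι →₀ ℕ) →+ ℤ) :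
    weightZero wt (∏ i : ι, geom (Finsupp.single i 1)) = indicator fun e => wt e = 0 := by
  classical
  ext e
  rw [prod_geom_single, coeff_weightZero, coeff_indicator, coeff_indicator]
  simp

theorem indicator_eq_coe_sum {α : Type*} (s : Finset α) (E : α → ι →₀ ℕ)
    (hE : Set.InjOn E s) (D : (ι →₀ ℕ) → Prop) (hD : ∀ e, D e ↔ ∃ b ∈ s, E b = e) :
    indicator D = ((∑ b ∈ s, MvPolynomial.monomial (E b) (1 : ℚ) : MvPolynomial ι ℚ) :
      MvPowerSeries ι ℚ) := by
  classical
  ext e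
  rw [coeff_indicator, MvPolynomial.coeff_coe, MvPolynomial.coeff_sum]
  simp only [MvPolynomial.coeff_monomial]
  split_ifs with h
  · obtain ⟨b, hb, rfl⟩ := (hD e).1 h
    rw [Finset.sum_eq_single b, if_pos rfl]
    · exact fun c hc hcb => if_neg fun h => hcb (hE hc hb h)
    · exact fun h => absurd hb h
  · symm
    refine Finset.sum_eq_zero fun b hb => if_neg fun hbe => h ((hD e).2 ⟨b, hb, hbe⟩)

end Indicator

/-! ### Evaluating rational power series -/

section Realize

variable {ι R : Type*} [CommRing R]

/-- The power series `s` is a rational function `P / Q`, and `x` is `U` times the value of `P / Q`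
under the homomorphism `ev`. -/
def Realizes (ev : MvPolynomial ι ℚ →+* R) (U : R) (s : MvPowerSeries ι ℚ) (x : R) : Prop :=
  ∃ Q P : MvPolynomial ι ℚ, ev Q ≠ 0 ∧ (Q : MvPowerSeries ι ℚ) * s = P ∧ ev P * U = ev Q * x

variable {ev : MvPolynomial ι ℚ →+* R} {U : R}

theorem Realizes.add [IsDomain R] {s t : MvPowerSeries ι ℚ} {x y : R} (h1 : Realizes ev U s x)
    (h2 : Realizes ev U t y) : Realizes ev U (s + t) (x + y) := by
  obtain ⟨Q, P, hQ, hs, hx⟩ := h1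
  obtain ⟨Q', P', hQ', hs', hx'⟩ := h2
  refine ⟨Q * Q', P * Q' + P' * Q, by rw [map_mul]; exact mul_ne_zero hQ hQ', ?_, ?_⟩
  · push_cast
    rw [← hs, ← hs']
    ring
  · simp only [map_add, map_mul]
    linear_combination ev Q' * hx + ev Q * hx'

theorem Realizes.neg {s : MvPowerSeries ι ℚ} {x : R} (h1 : Realizes ev U s x) :
    Realizes ev U (-s) (-x) := by
  obtain ⟨Q, P, hQ, hs, hx⟩ := h1
  refine ⟨-Q, P, by simpa using hQ, ?_, ?_⟩
  · rw [← hs, ← MvPolynomial.coeToMvPowerSeries.ringHom_apply,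
      ← MvPolynomial.coeToMvPowerSeries.ringHom_apply, map_neg]
    ring
  · rw [hx, map_neg]
    ring

/-- Exponentials have constant term `1`, so they cannot be substituted into an arbitrary power
series. The value is defined through a fraction instead, and this independence of the fraction
allows the two computations of `F` to be compared. -/
theorem Realizes.unique [IsDomain R] {s : MvPowerSeries ι ℚ} {x y : R} (h1 : Realizes ev U s x)
    (h2 : Realizes ev U s y) : x = y := by
  obtain ⟨Q, P, hQ, hs, hx⟩ := h1
  obtain ⟨Q', P', hQ', hs', hx'⟩ := h2
  have h : P * Q' = P' * Q := by
    apply MvPolynomial.coe_injective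
    push_cast
    rw [← hs, ← hs']
    ring
  have h' := congrArg ev h
  simp only [map_mul] at h'
  have : ev Q * ev Q' * x = ev Q * ev Q' * y := by
    linear_combination -ev Q' * hx + ev Q * hx' + U * h'
  exact mul_left_cancel₀ (mul_ne_zero hQ hQ') this

/-- The power series realized by an element of an additive subgroup. -/
def realizedBy [IsDomain R] (ev : MvPolynomial ι ℚ →+* R) (U : R) (A : AddSubgroup R) :
    AddSubgroup (MvPowerSeries ι ℚ) where
  carrier := {s | ∃ x ∈ A, Realizes ev U s x}
  zero_mem' := ⟨0, A.zero_mem, 1, 0, by simp, by simp, by simp⟩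
  add_mem' := by
    rintro s t ⟨x, hx, h⟩ ⟨y, hy, h'⟩
    exact ⟨x + y, A.add_mem hx hy, h.add h'⟩
  neg_mem' := by
    rintro s ⟨x, hx, h⟩
    exact ⟨-x, A.neg_mem hx, h.neg⟩

/-- Omitting one index outside `J` leaves exactly `n` slots to share the factor `u ^ n`; a slot
outside `J` keeps its `u`. -/
theorem realizes_prod_geom [IsDomain R] {n : ℕ} (u : R)
    (ev : MvPolynomial (Fin (n + 1)) ℚ →+* R)
    (v : Fin (n + 1) → Fin (n + 1) →₀ ℕ) (hv : ∀ i, v i ≠ 0) (J : Finset (Fin (n + 1)))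
    (i₀ : Fin (n + 1)) (hi₀ : i₀ ∉ J) (t : Fin (n + 1) → R)
    (hne : ∀ i ∈ J, ev (1 - MvPolynomial.monomial (v i) 1) ≠ 0)
    (ht : ∀ i ∈ J, ev (1 - MvPolynomial.monomial (v i) 1) * t i = u) :
    Realizes ev (u ^ n) (∏ i ∈ J, geom (v i))
      (∏ a : Fin n, if i₀.succAbove a ∈ J then t (i₀.succAbove a) else u) := by
  refine ⟨∏ i ∈ J, (1 - MvPolynomial.monomial (v i) 1), 1, ?_, ?_, ?_⟩
  · rw [map_prod]
    exact Finset.prod_ne_zero_iff.2 hne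
  · rw [← MvPolynomial.coeToMvPowerSeries.ringHom_apply, map_prod, ← Finset.prod_mul_distrib]
    rw [MvPolynomial.coe_one]
    refine Finset.prod_eq_one fun i _ => ?_
    rw [map_sub, map_one, MvPolynomial.coeToMvPowerSeries.ringHom_apply,
      MvPolynomial.coe_monomial]
    exact one_sub_mul_geom (hv i)
  · rw [map_one, one_mul, map_prod]
    have : ∏ i ∈ J, ev (1 - MvPolynomial.monomial (v i) 1) =
        ∏ a : Fin n, if i₀.succAbove a ∈ J then
          ev (1 - MvPolynomial.monomial (v (i₀.succAbove a)) 1) else 1 := by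
      rw [← Finset.prod_ite_mem_eq, Fin.prod_univ_succAbove _ i₀, if_neg hi₀, one_mul]
    rw [this, ← Finset.prod_mul_distrib]
    symm
    rw [Finset.prod_congr rfl (g := fun _ => u), Finset.prod_const, Finset.card_fin]
    intro a _
    split_ifs with h
    · exact ht _ h
    · exact one_mul u

end Realize

/-! ### The ring of fractions with primitive denominator -/

section GaussRing

open Polynomial

/-- The fractions of integral polynomials with primitive denominator. -/
noncomputable def gaussSubring : Subring (FractionRing ℤ[X]) where
  carrier := {x | ∃ f g : ℤ[X], g.IsPrimitive ∧ x * algebraMap _ _ g = algebraMap _ _ f}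
  zero_mem' := ⟨0, 1, isPrimitive_one, by simp⟩
  one_mem' := ⟨1, 1, isPrimitive_one, by simp⟩
  add_mem' := by
    rintro x y ⟨f, g, hg, h⟩ ⟨f', g', hg', h'⟩
    refine ⟨f * g' + f' * g, g * g', hg.mul hg', ?_⟩
    simp only [map_add, map_mul]
    rw [← h, ← h']
    ring
  mul_mem' := by
    rintro x y ⟨f, g, hg, h⟩ ⟨f', g', hg', h'⟩
    refine ⟨f * f', g * g', hg.mul hg', ?_⟩
    simp only [map_mul]
    rw [← h, ← h']
    ring
  neg_mem' := by
    rintro x ⟨f, g, hg, h⟩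
    exact ⟨-f, g, hg, by rw [map_neg, ← h, neg_mul]⟩

theorem algebraMap_mem_gaussSubring (f : ℤ[X]) :
    algebraMap ℤ[X] (FractionRing ℤ[X]) f ∈ gaussSubring :=
  ⟨f, 1, isPrimitive_one, by simp⟩

theorem inv_algebraMap_mem_gaussSubring {f : ℤ[X]} (hf : f.IsPrimitive) :
    (algebraMap ℤ[X] (FractionRing ℤ[X]) f)⁻¹ ∈ gaussSubring := by
  refine ⟨1, f, hf, ?_⟩
  rw [map_one, inv_mul_cancel₀]
  simpa using hf.ne_zero

/-- Clearing the denominator gives `a g = b f` with `g` primitive; compare contents. -/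
theorem dvd_of_eq_mul_of_mem_gaussSubring {a b : ℤ} {w : FractionRing ℤ[X]}
    (hw : w ∈ gaussSubring) (h : (a : FractionRing ℤ[X]) = b * w) : b ∣ a := by
  obtain ⟨f, g, hg, hfg⟩ := hw
  have h1 : C a * g = C b * f := by
    apply IsFractionRing.injective ℤ[X] (FractionRing ℤ[X])
    rw [map_mul, map_mul, ← hfg]
    simp only [eq_intCast, map_intCast]
    rw [h]
    ring
  have h2 : b ∣ (C a * g).content := by
    rw [dvd_content_iff_C_dvd, h1]
    exact dvd_mul_right _ _
  rw [content_C_mul, hg.content_eq_one, mul_one] at h2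
  exact (dvd_normalize_iff).1 h2

theorem isPrimitive_sum_C_mul_X_pow {n : ℕ} (e f : Fin n → ℤ) (h : ∑ l, f l * e l = 1) :
    (∑ l : Fin n, C (e l) * X ^ (l : ℕ)).IsPrimitive := by
  intro r hr
  rw [C_dvd_iff_dvd_coeff] at hr
  have h1 : ∀ l : Fin n, r ∣ e l := fun l => by
    have := hr l
    rw [finsetSum_coeff, Finset.sum_eq_single l] at this
    · simpa using this
    · intro b _ hb
      rw [coeff_C_mul_X_pow, if_neg]
      exact fun h => hb (Fin.ext h.symm)
    · simp
  apply isUnit_of_dvd_one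
  rw [← h]
  exact Finset.dvd_sum fun l _ => (h1 l).mul_left _

theorem isPrimitive_C_add_C_mul_X_pow {a b : ℕ} (h : a.Coprime b) (n : ℕ) :
    (C (a : ℤ) + C (b : ℤ) * X ^ (n + 1)).IsPrimitive := by
  intro r hr
  rw [C_dvd_iff_dvd_coeff] at hr
  have h0 : r ∣ a := by simpa [coeff_C] using hr 0
  have h1 : r ∣ b := by simpa [coeff_C] using hr (n + 1)
  exact (Nat.isCoprime_iff_coprime.2 h).isUnit_of_dvd' h0 h1

end GaussRing

/-! ### Power series over the Gauss ring -/

section IntegralSeries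

open Polynomial

/-- The power series whose coefficients are in `gaussSubring`. -/
noncomputable def integralSeries (n : ℕ) : Subring (MvPowerSeries (Fin n) (FractionRing ℤ[X])) :=
  (MvPowerSeries.map gaussSubring.subtype).range

theorem coeff_mem_of_mem_integralSeries {n : ℕ} {s : MvPowerSeries (Fin n) (FractionRing ℤ[X])}
    (hs : s ∈ integralSeries n) (e : Fin n →₀ ℕ) : MvPowerSeries.coeff e s ∈ gaussSubring := by
  obtain ⟨t, rfl⟩ := hs
  rw [MvPowerSeries.coeff_map]
  exact (MvPowerSeries.coeff e t).2

theorem X_mem_integralSeries {n : ℕ} (i : Fin n) : MvPowerSeries.X i ∈ integralSeries n :=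
  ⟨MvPowerSeries.X i, MvPowerSeries.map_X _ _⟩

theorem C_mem_integralSeries {n : ℕ} {w : FractionRing ℤ[X]} (hw : w ∈ gaussSubring) :
    MvPowerSeries.C w ∈ integralSeries n :=
  ⟨MvPowerSeries.C ⟨w, hw⟩, MvPowerSeries.map_C _ _⟩

theorem inv_mem_integralSeries {n : ℕ} {s : MvPowerSeries (Fin n) (FractionRing ℤ[X])}
    (hs : s ∈ integralSeries n) (h0 : MvPowerSeries.constantCoeff s ≠ 0)
    (h : (MvPowerSeries.constantCoeff s)⁻¹ ∈ gaussSubring) : s⁻¹ ∈ integralSeries n := by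
  obtain ⟨t, rfl⟩ := hs
  have hu : IsUnit t := by
    rw [MvPowerSeries.isUnit_iff_constantCoeff]
    rw [MvPowerSeries.constantCoeff_map] at h h0
    refine IsUnit.of_mul_eq_one ⟨_, h⟩ (Subtype.ext ?_)
    exact mul_inv_cancel₀ h0
  obtain ⟨u, rfl⟩ := hu
  refine ⟨((u⁻¹ : _ˣ) : MvPowerSeries (Fin n) gaussSubring), ?_⟩
  symm
  rw [MvPowerSeries.inv_eq_iff_mul_eq_one h0, ← map_mul, Units.inv_mul, map_one]

end IntegralSeries

/-! ### Todd series and exponential substitution -/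

section TwistedTodd

open PowerSeries

variable {L : Type*} [CommRing L] [Algebra ℚ L]

/-- The series `u e^{xℓu} / (1 - e^{ℓu})`, where `ℓ'` is the inverse of `ℓ`. -/
noncomputable def twistedTodd (ℓ ℓ' : L) (x : ℚ) : L⟦X⟧ :=
  mk fun m => ((m ! : ℚ)⁻¹ * (Polynomial.bernoulli m).eval x) • -(ℓ ^ m * ℓ')

/-- This is the generating function of the Bernoulli polynomials rescaled by `ℓ`; the denominator `1
- e^{ℓu}`, in place of `e^{ℓu} - 1`, accounts for the sign. -/
theorem one_sub_exp_mul_twistedTodd {ℓ ℓ' : L} (h : ℓ * ℓ' = 1) (x : ℚ) :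
    (1 - rescale ℓ (exp L)) * twistedTodd ℓ ℓ' x =
      X * rescale (algebraMap ℚ L x * ℓ) (exp L) := by
  have h1 := congrArg (rescale ℓ) (Polynomial.bernoulli_generating_function (algebraMap ℚ L x))
  have h2 : twistedTodd ℓ ℓ' x = -C ℓ' * rescale ℓ (mk fun n =>
      Polynomial.aeval (algebraMap ℚ L x) ((1 / n ! : ℚ) • Polynomial.bernoulli n)) := by
    ext m
    rw [neg_mul, map_neg, coeff_C_mul, coeff_rescale, twistedTodd, coeff_mk, coeff_mk, map_smul,
      Polynomial.aeval_algebraMap_apply_eq_algebraMap_eval, Algebra.smul_def, Algebra.smul_def,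
      map_mul, one_div]
    ring
  rw [map_mul, map_mul, map_sub, map_one, rescale_X, rescale_rescale] at h1
  rw [h2]
  have h3 : C ℓ * C ℓ' = (1 : L⟦X⟧) := by rw [← map_mul, h, map_one]
  linear_combination C ℓ' * h1 + X * rescale (algebraMap ℚ L x * ℓ) (exp L) * h3

theorem prod_rescale_exp {κ : Type*} (s : Finset κ) (a : κ → L) :
    ∏ i ∈ s, rescale (a i) (exp L) = rescale (∑ i ∈ s, a i) (exp L) := by
  classical
  induction s using Finset.induction_on with
  | empty =>
    ext m
    cases m <;> simp [coeff_one]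
  | insert i s hi ih =>
    rw [Finset.prod_insert hi, Finset.sum_insert hi, ih, exp_mul_exp_eq_exp_add]

theorem rescale_exp_pow (a : L) (k : ℕ) :
    rescale a (exp L) ^ k = rescale (k * a) (exp L) := by
  rw [← map_pow, exp_pow_eq_rescale_exp, rescale_rescale]

theorem one_sub_rescale_exp_ne_zero [Nontrivial L] {ℓ ℓ' : L} (h : ℓ * ℓ' = 1) :
    1 - rescale ℓ (exp L) ≠ 0 := by
  intro h0
  have := congrArg (coeff 1) h0
  simp only [map_sub, coeff_one, coeff_rescale, coeff_exp] at this
  simp only [one_ne_zero, if_false, pow_one, Nat.factorial_one, Nat.cast_one, div_one, map_one,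
    mul_one, zero_sub, map_zero, neg_eq_zero] at this
  simp [this] at h

/-- The substitution `X_i ↦ e^{λ_i u}`. -/
noncomputable def expSubst {ι : Type*} (lam : ι → L) : MvPolynomial ι ℚ →+* L⟦X⟧ :=
  MvPolynomial.eval₂Hom (algebraMap ℚ L⟦X⟧) fun i => rescale (lam i) (exp L)

theorem expSubst_monomial {ι : Type*} [Fintype ι] (lam : ι → L) (v : ι →₀ ℕ) :
    expSubst lam (MvPolynomial.monomial v 1) =
      rescale (∑ i, (v i : L) * lam i) (exp L) := by
  rw [expSubst, MvPolynomial.coe_eval₂Hom, MvPolynomial.eval₂_monomial, map_one, one_mul,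
    Finsupp.prod_fintype _ _ (fun i => pow_zero _), ← prod_rescale_exp]
  simp only [rescale_exp_pow]

omit [Algebra ℚ L] in
theorem coeff_prod_mk {n : ℕ} (f : Fin n → ℕ → L) (N : ℕ) :
    coeff N (∏ i, mk (f i)) =
      ∑ m ∈ Finset.piAntidiag (Finset.univ : Finset (Fin n)) N, ∏ i, f i (m i) := by
  rw [coeff_prod]
  refine Finset.sum_bij (fun l _ => (l : Fin n → ℕ)) ?_ ?_ ?_ ?_
  · intro l hl
    rw [Finset.mem_finsuppAntidiag] at hl
    simp [Finset.mem_piAntidiag, hl.1]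
  · exact fun a _ b _ h => DFunLike.coe_injective h
  · intro m hm
    rw [Finset.mem_piAntidiag] at hm
    exact ⟨Finsupp.equivFunOnFinite.symm m, by simp [Finset.mem_finsuppAntidiag, hm.1], by simp⟩
  · intro l _
    simp only [coeff_mk]

end TwistedTodd

/-! ### The generic exponents -/

section Lambda

open Polynomial

variable {n : ℕ} (q : ℕ) (P : Fin n → ℕ)

/-- The coordinates of a generic vector of the lattice `ℤⁿ + ℤ (P / q)`. -/
noncomputable def genericVector (i : Fin n) : FractionRing ℤ[X] :=
  (q : FractionRing ℤ[X])⁻¹ * algebraMap ℤ[X] _ (C (P i : ℤ) + C (q : ℤ) * X ^ ((i : ℕ) + 1))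

/-- The exponents of the substitution: `0` for the auxiliary variable, and the formal variables
translated by the generic vector for the others. -/
noncomputable def genericExponent : Fin (n + 1) → MvPowerSeries (Fin n) (FractionRing ℤ[X]) :=
  Fin.cons 0 fun i => MvPowerSeries.C (genericVector q P i) + MvPowerSeries.X i

/-- The weight `∑ P_i e_i - q e_0` of an exponent vector. -/
noncomputable def weight : (Fin (n + 1) →₀ ℕ) →+ ℤ where
  toFun e := ∑ i, (P i : ℤ) * e (Fin.succ i) - q * e 0
  map_zero' := by simp
  map_add' a b := by
    simp only [Finsupp.add_apply, Nat.cast_add, mul_add, Finset.sum_add_distrib]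
    ring

theorem weight_apply (e : Fin (n + 1) →₀ ℕ) :
    weight q P e = ∑ i, (P i : ℤ) * e (Fin.succ i) - q * e 0 := rfl

/-- Weight zero means `∑ Pᵢ vᵢ / q = v₀`, so the denominator `q` disappears and `v₀` takes the place
of the constant coefficient. -/
theorem sum_mul_genericExponent (hq : 0 < q) {v : Fin (n + 1) →₀ ℕ} (hv : weight q P v = 0) :
    ∑ i, (v i : MvPowerSeries (Fin n) (FractionRing ℤ[X])) * genericExponent q P i =
      MvPowerSeries.C (algebraMap ℤ[X] _ (∑ l : Fin (n + 1), C (v l : ℤ) * X ^ (l : ℕ))) +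
        ∑ i : Fin n, (v i.succ : MvPowerSeries (Fin n) (FractionRing ℤ[X])) *
          MvPowerSeries.X i := by
  have hq' : (q : FractionRing ℤ[X]) ≠ 0 := by exact_mod_cast hq.ne'
  rw [Fin.sum_univ_succ]
  simp only [genericExponent, Fin.cons_zero, Fin.cons_succ, mul_zero, zero_add, mul_add,
    Finset.sum_add_distrib]
  congr 1
  have h : ∀ i : Fin n, (v i.succ : MvPowerSeries (Fin n) (FractionRing ℤ[X])) *
      MvPowerSeries.C (genericVector q P i) =
      MvPowerSeries.C ((v i.succ : FractionRing ℤ[X]) * genericVector q P i) := fun i => by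
    rw [map_mul, map_natCast]
  simp only [h]
  rw [← map_sum]
  congr 1
  rw [Fin.sum_univ_succ]
  apply mul_left_cancel₀ hq'
  have hw : ∑ i, (P i : FractionRing ℤ[X]) * v (Fin.succ i) = q * v 0 := by
    rw [weight_apply, sub_eq_zero] at hv
    exact_mod_cast congrArg (Int.cast : ℤ → FractionRing ℤ[X]) hv
  simp only [Fin.val_zero, pow_zero, mul_one, Fin.val_succ, map_add, map_sum, map_mul,
    genericVector, mul_add, Finset.mul_sum]
  simp only [map_natCast]
  rw [← hw, ← Finset.sum_add_distrib]
  refine Finset.sum_congr rfl fun i _ => ?_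
  field_simp

theorem constantCoeff_sum_mul_X (a : Fin n → ℕ) (w : FractionRing ℤ[X]) :
    MvPowerSeries.constantCoeff (MvPowerSeries.C w + ∑ i : Fin n,
      (a i : MvPowerSeries (Fin n) (FractionRing ℤ[X])) * MvPowerSeries.X i) = w := by
  simp

/-- The functional `f` makes the coordinates of `v` coprime, hence the constant term a primitive
polynomial and the series integrally invertible. -/
theorem sum_mul_genericExponent_spec (hq : 0 < q) {v : Fin (n + 1) →₀ ℕ}
    (hv : weight q P v = 0) (f : Fin (n + 1) → ℤ) (hf : ∑ l, f l * (v l : ℤ) = 1) :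
    ∃ ℓ' ∈ integralSeries n,
      (∑ i, (v i : MvPowerSeries (Fin n) (FractionRing ℤ[X])) * genericExponent q P i) ∈
        integralSeries n ∧
      (∑ i, (v i : MvPowerSeries (Fin n) (FractionRing ℤ[X])) * genericExponent q P i) * ℓ' =
        1 := by
  rw [sum_mul_genericExponent q P hq hv]
  have hprim := isPrimitive_sum_C_mul_X_pow (fun l => (v l : ℤ)) f hf
  set F := ∑ l : Fin (n + 1), C (v l : ℤ) * X ^ (l : ℕ)
  have hmem : MvPowerSeries.C (algebraMap ℤ[X] (FractionRing ℤ[X]) F) + ∑ i : Fin n,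
      (v i.succ : MvPowerSeries (Fin n) (FractionRing ℤ[X])) * MvPowerSeries.X i ∈
      integralSeries n :=
    add_mem (C_mem_integralSeries (algebraMap_mem_gaussSubring F))
      (sum_mem fun i _ => mul_mem (natCast_mem _ _) (X_mem_integralSeries i))
  have hc := constantCoeff_sum_mul_X (fun i => v i.succ) (algebraMap ℤ[X] (FractionRing ℤ[X]) F)
  have h0 : algebraMap ℤ[X] (FractionRing ℤ[X]) F ≠ 0 := by
    simpa using hprim.ne_zero
  exact ⟨_, inv_mem_integralSeries hmem (by rw [hc]; exact h0)
    (by rw [hc]; exact inv_algebraMap_mem_gaussSubring hprim), hmem,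
    MvPowerSeries.mul_inv_cancel _ (by rw [hc]; exact h0)⟩

end Lambda

/-! ### Denominators from Elliott's decomposition -/

section Integrality

open Polynomial

theorem toddDenom_smul_coeff_prod_mem {n N : ℕ}
    (b : Fin n → ℕ → MvPowerSeries (Fin n) (FractionRing ℤ[X]))
    (hb : ∀ i m, b i m ∈ integralSeries n) :
    (toddDenom N n : ℚ) • PowerSeries.coeff N
      (∏ i, PowerSeries.mk fun m => ((m ! : ℚ)⁻¹ * (Polynomial.bernoulli m).eval 0) • b i m) ∈
      integralSeries n := by
  rw [coeff_prod_mk, Finset.smul_sum]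
  refine sum_mem fun m hm => ?_
  rw [Finset.mem_piAntidiag] at hm
  have h : (toddDenom N n : ℚ) • ∏ i, (((m i)! : ℚ)⁻¹ * (Polynomial.bernoulli (m i)).eval 0) •
      b i (m i) = (scaledBernoulli m : MvPowerSeries (Fin n) (FractionRing ℤ[X])) *
        ∏ i, b i (m i) := by
    rw [← map_intCast (algebraMap ℚ (MvPowerSeries (Fin n) (FractionRing ℤ[X]))),
      cast_scaledBernoulli, hm.1, ← Algebra.smul_def, mul_smul, bernoulliQuot]
    simp only [Polynomial.bernoulli_eval_zero, div_eq_inv_mul, Algebra.smul_def,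
      Finset.prod_mul_distrib, map_prod, map_mul]
  rw [h]
  exact mul_mem (intCast_mem _ _) (prod_mem fun i _ => hb i _)

instance isDomain_mvPowerSeries (σ K : Type*) [Field K] : IsDomain (MvPowerSeries σ K) :=
  NoZeroDivisors.to_isDomain _

/-- Since `B₁ = -1/2`, the series `u` is `-2 · (B₁ / 1!) u`. A slot without a factor thus also has
Bernoulli form with integral coefficients, and the denominator for `n` variables in degree `N`
suffices for short products too. -/
theorem X_eq_mk_bernoulli (L : Type*) [CommRing L] [Algebra ℚ L] :
    (PowerSeries.X : PowerSeries L) = PowerSeries.mk fun m =>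
      ((m ! : ℚ)⁻¹ * (Polynomial.bernoulli m).eval 0) • if m = 1 then (-2 : L) else 0 := by
  ext m
  rw [PowerSeries.coeff_X, PowerSeries.coeff_mk]
  split_ifs with h
  · subst h
    have : (-2 : L) = algebraMap ℚ L (-2) := by rw [map_neg, map_ofNat]
    rw [this, Algebra.smul_def, ← map_mul]
    norm_num [Polynomial.bernoulli_one]
  · simp

/-- Every power series realizing the weight zero part of `∏ 1 / (1 - X_i)` has integral
coefficients after multiplication by the Todd denominator. -/
theorem toddDenom_smul_coeff_mem {n : ℕ} (N q : ℕ) (P : Fin n → ℕ) (hq : 0 < q)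
    {x : PowerSeries (MvPowerSeries (Fin n) (FractionRing ℤ[X]))}
    (hx : Realizes (expSubst (genericExponent q P)) (PowerSeries.X ^ n)
      (indicator fun e => weight q P e = 0) x) :
    (toddDenom N n : ℚ) • PowerSeries.coeff N x ∈ integralSeries n := by
  set L := MvPowerSeries (Fin n) (FractionRing ℤ[X])
  let A : AddSubgroup (PowerSeries L) :=
    { carrier := {x | (toddDenom N n : ℚ) • PowerSeries.coeff N x ∈ integralSeries n}
      zero_mem' := by simp [zero_mem]
      add_mem' := by
        intro a b ha hb
        simp only [Set.mem_ofPred_eq, map_add, smul_add] at ha hb ⊢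
        exact add_mem ha hb
      neg_mem' := by
        intro a ha
        simp only [Set.mem_ofPred_eq, map_neg, smul_neg] at ha ⊢
        exact neg_mem ha }
  have key : indicator (fun e => weight q P e = 0) ∈
      realizedBy (expSubst (genericExponent q P)) (PowerSeries.X ^ n) A := by
    rw [← weightZero_prod_geom_single]
    refine weightZero_prod_geom_single_mem _ 0 ?_ _ ?_
    · rw [weight_apply]
      simp [hq.ne']
    intro v J hv hJ hw
    obtain ⟨i₀, hi₀⟩ : ∃ i, i ∉ J := by
      by_contra hcon
      push Not at hcon
      exact hJ (Finset.eq_univ_iff_forall.2 hcon)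
    have hspec : ∀ i, ∃ ℓ' ∈ integralSeries n, i ∈ J →
      (∑ l, (v i l : L) * genericExponent q P l) ∈ integralSeries n ∧
      (∑ l, (v i l : L) * genericExponent q P l) * ℓ' = 1 := by
      intro i
      by_cases hi : i ∈ J
      · obtain ⟨f, hf⟩ := hv.exists_functional i
        obtain ⟨ℓ', h1, h2⟩ := sum_mul_genericExponent_spec q P hq (hw i hi) f hf
        exact ⟨ℓ', h1, fun _ => h2⟩
      · exact ⟨0, zero_mem _, fun h => absurd h hi⟩
    choose ℓ' hℓ' hℓ using hspec
    refine ⟨_, ?_, realizes_prod_geom PowerSeries.X _ v hv.ne_zero J i₀ hi₀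
      (fun i => twistedTodd (∑ l, (v i l : L) * genericExponent q P l) (ℓ' i) 0) ?_ ?_⟩
    · have e : ∀ a : Fin n, (if i₀.succAbove a ∈ J then
          twistedTodd (∑ l, (v (i₀.succAbove a) l : L) * genericExponent q P l)
            (ℓ' (i₀.succAbove a)) 0 else PowerSeries.X) = PowerSeries.mk fun m =>
          ((m ! : ℚ)⁻¹ * (Polynomial.bernoulli m).eval 0) • if i₀.succAbove a ∈ J then
            -((∑ l, (v (i₀.succAbove a) l : L) * genericExponent q P l) ^ m *
              ℓ' (i₀.succAbove a)) else if m = 1 then (-2 : L) else 0 := by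
        intro a
        split_ifs with h
        · rfl
        · exact X_eq_mk_bernoulli L
      simp only [e]
      refine toddDenom_smul_coeff_prod_mem _ fun a m => ?_
      split_ifs with h h'
      · exact neg_mem (mul_mem (pow_mem (hℓ _ h).1 _) (hℓ' _))
      · exact neg_mem (ofNat_mem _ _)
      · exact zero_mem _
    · intro i hi
      rw [map_sub, map_one, expSubst_monomial]
      exact one_sub_rescale_exp_ne_zero (hℓ i hi).2
    · intro i hi
      rw [map_sub, map_one, expSubst_monomial, one_sub_exp_mul_twistedTodd (hℓ i hi).2]
      have : PowerSeries.rescale (0 : L) (PowerSeries.exp L) = 1 := by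
        have := prod_rescale_exp (∅ : Finset ℕ) fun _ => (0 : L)
        rwa [Finset.prod_empty, Finset.sum_empty, eq_comm] at this
      rw [map_zero, zero_mul, this, mul_one]
  obtain ⟨y, hy, hy'⟩ := key
  rw [hx.unique hy']
  exact hy

end Integrality

/-! ### The simplicial cone and its box -/

section Box

open Polynomial

variable {n : ℕ} (q : ℕ) (P : Fin n → ℕ)

/-- The points of the box `[0, q)ⁿ` on which the linear form `P` is divisible by `q`. -/
def box : Finset (Fin n → Fin q) := Finset.univ.filter fun b => q ∣ ∑ i, P i * (b i : ℕ)

/-- The exponent vector of weight zero that extends a point of the box. -/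
noncomputable def boxExponent (b : Fin n → Fin q) : Fin (n + 1) →₀ ℕ :=
  Finsupp.equivFunOnFinite.symm
    (Fin.cons ((∑ i, P i * (b i : ℕ)) / q) fun i => (b i : ℕ) : Fin (n + 1) → ℕ)

theorem boxExponent_zero (b : Fin n → Fin q) :
    boxExponent q P b 0 = (∑ i, P i * (b i : ℕ)) / q := rfl

theorem boxExponent_succ (b : Fin n → Fin q) (i : Fin n) : boxExponent q P b i.succ = b i := rfl

/-- The exponent vector `q e_i + P_i e_0`. -/
noncomputable def edge (i : Fin n) : Fin (n + 1) →₀ ℕ :=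
  Finsupp.single i.succ q + Finsupp.single 0 (P i)

theorem edge_zero (i : Fin n) : edge q P i 0 = P i := by simp [edge]

theorem edge_succ (i j : Fin n) : edge q P i j.succ = if i = j then q else 0 := by
  simp [edge, Finsupp.single_apply]

theorem weight_edge (i : Fin n) : weight q P (edge q P i) = 0 := by
  simp only [weight_apply, edge_zero, edge_succ, Nat.cast_ite, Nat.cast_zero, mul_ite, mul_zero,
    Finset.sum_ite_eq, Finset.mem_univ, if_true]
  ring

theorem edge_le (hq : 0 < q) (i : Fin n) (e : Fin (n + 1) →₀ ℕ) (he : q ≤ e i.succ)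
    (hw : weight q P e = 0) : edge q P i ≤ e := by
  intro j
  induction j using Fin.cases with
  | zero =>
    rw [edge_zero]
    rw [weight_apply, sub_eq_zero] at hw
    have h1 : ∑ j, P j * e j.succ = q * e 0 := by exact_mod_cast hw
    -- Only the auxiliary coordinate needs an argument: `q e₀ ≥ Pᵢ eᵢ ≥ Pᵢ q`.
    have h2 : P i * e i.succ ≤ ∑ j, P j * e j.succ :=
      Finset.single_le_sum (f := fun j => P j * e j.succ) (fun _ _ => Nat.zero_le _)
        (Finset.mem_univ i)
    have h3 : P i * q ≤ P i * e i.succ := Nat.mul_le_mul_left _ he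
    have h4 : q * P i ≤ q * e 0 := by rw [mul_comm]; omega
    exact Nat.le_of_mul_le_mul_left h4 hq
  | succ j =>
    rw [edge_succ]
    split_ifs with h
    · subst h; exact he
    · exact Nat.zero_le _

theorem prod_edge_mul_indicator (hq : 0 < q) :
    (∏ i : Fin n, (1 - MvPowerSeries.monomial (edge q P i) (1 : ℚ))) *
      indicator (fun e => weight q P e = 0) =
      indicator fun e => weight q P e = 0 ∧ ∀ i : Fin n, e i.succ < q := by
  have h := prod_one_sub_monomial_mul_indicator (Fin.cons 0 (edge q P)) (fun _ => q)
    (fun e => weight q P e = 0) (Finset.univ.map (Fin.succEmb n)) ?_ ?_ ?_ ?_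
  · rw [Finset.prod_map] at h
    simpa only [Finset.mem_map, Finset.mem_univ, true_and, Fin.coe_succEmb, Fin.cons_succ,
      forall_exists_index, forall_apply_eq_imp_iff] using h
  · simp only [Finset.mem_map, Finset.mem_univ, true_and, Fin.coe_succEmb]
    rintro _ ⟨i, rfl⟩ e hle he
    rw [Fin.cons_succ] at hle he
    obtain ⟨d, rfl⟩ := exists_add_of_le hle
    rw [add_tsub_cancel_left] at he
    rw [map_add, he, weight_edge, add_zero]
  · simp only [Finset.mem_map, Finset.mem_univ, true_and, Fin.coe_succEmb]
    rintro _ ⟨i, rfl⟩ e hle he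
    rw [Fin.cons_succ]
    have hle := edge_le q P hq i e hle he
    refine ⟨hle, ?_⟩
    obtain ⟨d, rfl⟩ := exists_add_of_le hle
    rw [map_add, weight_edge, zero_add] at he
    rwa [add_tsub_cancel_left]
  · simp only [Finset.mem_map, Finset.mem_univ, true_and, Fin.coe_succEmb]
    rintro _ ⟨i, rfl⟩
    rw [Fin.cons_succ, edge_succ, if_pos rfl]
  · simp only [Finset.mem_map, Finset.mem_univ, true_and, Fin.coe_succEmb]
    rintro _ ⟨i, rfl⟩ _ ⟨j, rfl⟩ hij
    rw [Fin.cons_succ, edge_succ, if_neg]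
    rintro rfl
    exact hij rfl

theorem injective_boxExponent : Function.Injective (boxExponent q P) := by
  intro a b h
  ext i
  exact DFunLike.congr_fun h i.succ

theorem weight_eq_zero_and_lt_iff (hq : 0 < q) (e : Fin (n + 1) →₀ ℕ) :
    (weight q P e = 0 ∧ ∀ i : Fin n, e i.succ < q) ↔ ∃ b ∈ box q P, boxExponent q P b = e := by
  constructor
  · rintro ⟨hw, hlt⟩
    rw [weight_apply, sub_eq_zero] at hw
    have h1 : ∑ j, P j * e j.succ = q * e 0 := by exact_mod_cast hw
    refine ⟨fun i => ⟨e i.succ, hlt i⟩, ?_, ?_⟩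
    · simp only [box, Finset.mem_filter, Finset.mem_univ, true_and]
      exact ⟨_, h1⟩
    · ext j
      induction j using Fin.cases with
      | zero =>
        rw [boxExponent_zero]
        simp only
        rw [h1, Nat.mul_div_cancel_left _ hq]
      | succ j => rw [boxExponent_succ]
  · rintro ⟨b, hb, rfl⟩
    simp only [box, Finset.mem_filter, Finset.mem_univ, true_and] at hb
    refine ⟨?_, fun i => by rw [boxExponent_succ]; exact (b i).2⟩
    rw [weight_apply, sub_eq_zero]
    simp only [boxExponent_zero, boxExponent_succ]
    have := Nat.mul_div_cancel' hb
    exact_mod_cast this.symm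

/-- The variable `X_i` translated by the generic vector. -/
noncomputable def shiftedVariable (i : Fin n) : MvPowerSeries (Fin n) (FractionRing ℤ[X]) :=
  MvPowerSeries.C (genericVector q P i) + MvPowerSeries.X i

theorem genericVector_ne_zero (hq : 0 < q) (i : Fin n) : genericVector q P i ≠ 0 := by
  have hq' : (q : FractionRing ℤ[X]) ≠ 0 := by exact_mod_cast hq.ne'
  refine mul_ne_zero (inv_ne_zero hq') ?_
  rw [Ne, map_eq_zero_iff _ (IsFractionRing.injective ℤ[X] (FractionRing ℤ[X]))]
  intro h
  have := congrArg (fun p => Polynomial.coeff p ((i : ℕ) + 1)) h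
  simp [hq.ne'] at this

theorem shiftedVariable_mul_inv (hq : 0 < q) (i : Fin n) :
    shiftedVariable q P i * (shiftedVariable q P i)⁻¹ = 1 := by
  refine MvPowerSeries.mul_inv_cancel _ ?_
  simpa [shiftedVariable] using genericVector_ne_zero q P hq i

theorem algebraMap_natCast_inv_mul (hq : 0 < q) :
    algebraMap ℚ (MvPowerSeries (Fin n) (FractionRing ℤ[X])) (q : ℚ)⁻¹ * q = 1 := by
  rw [← map_natCast (algebraMap ℚ (MvPowerSeries (Fin n) (FractionRing ℤ[X]))), ← map_mul,
    inv_mul_cancel₀ (by exact_mod_cast hq.ne'), map_one]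

/-- The generating series of the box, a sum of products of twisted Todd series. -/
noncomputable def boxSeries : PowerSeries (MvPowerSeries (Fin n) (FractionRing ℤ[X])) :=
  ∑ b ∈ box q P, ∏ i, twistedTodd (q * shiftedVariable q P i)
    (algebraMap ℚ _ (q : ℚ)⁻¹ * (shiftedVariable q P i)⁻¹) ((b i : ℚ) / q)

/-- As `λ₀ = 0`, an edge becomes `e^{q λᵢ u}`, and a box point becomes the product of `e^{(bᵢ / q)(q
λᵢ) u}`, which are the numerators of the twisted Todd series. -/
theorem realizes_indicator_weight (hq : 0 < q) :
    Realizes (expSubst (genericExponent q P)) (PowerSeries.X ^ n)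
      (indicator fun e => weight q P e = 0) (boxSeries q P) := by
  set L := MvPowerSeries (Fin n) (FractionRing ℤ[X])
  have hinv : ∀ i, ((q : L) * shiftedVariable q P i) *
      (algebraMap ℚ L (q : ℚ)⁻¹ * (shiftedVariable q P i)⁻¹) = 1 := fun i => by
    linear_combination (shiftedVariable q P i * (shiftedVariable q P i)⁻¹) *
      algebraMap_natCast_inv_mul (n := n) q hq + shiftedVariable_mul_inv q P hq i
  have hev : ∀ i, expSubst (genericExponent q P)
      (1 - MvPolynomial.monomial (edge q P i) 1) =
      1 - PowerSeries.rescale ((q : L) * shiftedVariable q P i) (PowerSeries.exp L) := fun i => by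
    rw [map_sub, map_one, expSubst_monomial, Fin.sum_univ_succ]
    simp only [genericExponent, Fin.cons_zero, Fin.cons_succ, mul_zero, zero_add, edge_succ,
      Nat.cast_ite, Nat.cast_zero, ite_mul, zero_mul, Finset.sum_ite_eq, Finset.mem_univ, if_true]
    rfl
  refine ⟨∏ i, (1 - MvPolynomial.monomial (edge q P i) 1),
    ∑ b ∈ box q P, MvPolynomial.monomial (boxExponent q P b) 1, ?_, ?_, ?_⟩
  · rw [map_prod]
    refine Finset.prod_ne_zero_iff.2 fun i _ => ?_
    rw [hev]
    exact one_sub_rescale_exp_ne_zero (hinv i)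
  · rw [← indicator_eq_coe_sum (box q P) (boxExponent q P)
      (injective_boxExponent q P).injOn _ (weight_eq_zero_and_lt_iff q P hq),
      ← prod_edge_mul_indicator q P hq, ← MvPolynomial.coeToMvPowerSeries.ringHom_apply, map_prod]
    congr 1
    refine Finset.prod_congr rfl fun i _ => ?_
    rw [map_sub, map_one, MvPolynomial.coeToMvPowerSeries.ringHom_apply,
      MvPolynomial.coe_monomial]
  · rw [map_prod, map_sum, boxSeries, Finset.mul_sum, Finset.sum_mul]
    refine Finset.sum_congr rfl fun b _ => ?_
    rw [← Finset.prod_mul_distrib, Finset.prod_congr rfl fun i _ =>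
      (congrArg (· * _) (hev i)).trans (one_sub_exp_mul_twistedTodd (hinv i) _)]
    rw [Finset.prod_mul_distrib, Finset.prod_const, Finset.card_fin, mul_comm, prod_rescale_exp,
      expSubst_monomial, Fin.sum_univ_succ]
    congr 2
    simp only [genericExponent, Fin.cons_zero, Fin.cons_succ, mul_zero, zero_add,
      boxExponent_succ]
    congr 1
    refine Finset.sum_congr rfl fun i _ => ?_
    rw [div_eq_mul_inv, map_mul, map_natCast, shiftedVariable]
    linear_combination (-(b i : L) * (MvPowerSeries.C (genericVector q P i) +
      MvPowerSeries.X i)) * algebraMap_natCast_inv_mul (n := n) q hq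

end Box

/-! ### Coefficients of the box series -/

section Binomial

open Polynomial

variable {n : ℕ} (q : ℕ) (P : Fin n → ℕ)

/-- The binomial expansion of `∏ (g_i + X_i) ^ a_i` at the generic vector `g`. -/
noncomputable def binomialSeries (a : Fin n → ℤ) : MvPowerSeries (Fin n) (FractionRing ℤ[X]) :=
  fun e => ∏ i, ((Ring.choose (a i) (e i) : ℤ) : FractionRing ℤ[X]) *
    genericVector q P i ^ (a i - e i)

theorem coeff_binomialSeries (a : Fin n → ℤ) (e : Fin n →₀ ℕ) :
    MvPowerSeries.coeff e (binomialSeries q P a) =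
      ∏ i, ((Ring.choose (a i) (e i) : ℤ) : FractionRing ℤ[X]) * genericVector q P i ^ (a i - e i) :=
  rfl

theorem binomialSeries_zero : binomialSeries q P 0 = 1 := by
  classical
  ext e
  rw [coeff_binomialSeries, MvPowerSeries.coeff_one]
  split_ifs with h
  · subst h
    simp
  · obtain ⟨i, hi⟩ : ∃ i, e i ≠ 0 := by
      by_contra hcon
      push Not at hcon
      exact h (Finsupp.ext hcon)
    refine Finset.prod_eq_zero (Finset.mem_univ i) ?_
    rw [Pi.zero_apply, Ring.choose_zero_pos ℤ (Nat.pos_of_ne_zero hi), Int.cast_zero, zero_mul]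

/-- Pascal's rule, valid for integer upper index, so negative exponents need no separate treatment.
-/
theorem shiftedVariable_mul_binomialSeries (hq : 0 < q) (a : Fin n → ℤ) (j : Fin n) :
    shiftedVariable q P j * binomialSeries q P a =
      binomialSeries q P (Function.update a j (a j + 1)) := by
  classical
  have hg := genericVector_ne_zero q P hq
  ext e
  rw [shiftedVariable, add_mul, map_add, MvPowerSeries.coeff_C_mul, MvPowerSeries.X,
    MvPowerSeries.coeff_monomial_mul, one_mul]
  simp only [coeff_binomialSeries]
  have split : ∀ f : Fin n → FractionRing ℤ[X], ∏ i, f i = f j * ∏ i ∈ Finset.univ.erase j, f i :=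
    fun f => (Finset.mul_prod_erase _ _ (Finset.mem_univ j)).symm
  rw [split, split, split]
  have h1 : ∏ i ∈ Finset.univ.erase j, ((Ring.choose (a i) ((e - Finsupp.single j 1 : Fin n →₀ ℕ) i) : ℤ) :
      FractionRing ℤ[X]) * genericVector q P i ^ (a i - ((e - Finsupp.single j 1 : Fin n →₀ ℕ) i : ℕ)) =
      ∏ i ∈ Finset.univ.erase j, ((Ring.choose (a i) (e i) : ℤ) : FractionRing ℤ[X]) *
        genericVector q P i ^ (a i - e i) := by
    refine Finset.prod_congr rfl fun i hi => ?_
    rw [Finsupp.tsub_apply, Finsupp.single_eq_of_ne (Finset.ne_of_mem_erase hi), tsub_zero]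
  have h2 : ∏ i ∈ Finset.univ.erase j, ((Ring.choose (Function.update a j (a j + 1) i) (e i) : ℤ) :
      FractionRing ℤ[X]) * genericVector q P i ^ (Function.update a j (a j + 1) i - e i) =
      ∏ i ∈ Finset.univ.erase j, ((Ring.choose (a i) (e i) : ℤ) : FractionRing ℤ[X]) *
        genericVector q P i ^ (a i - e i) := by
    refine Finset.prod_congr rfl fun i hi => ?_
    rw [Function.update_of_ne (Finset.ne_of_mem_erase hi)]
  rw [h1, h2, Function.update_self, Finsupp.tsub_apply, Finsupp.single_eq_same]
  rcases hej : e j with _ | c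
  · have : ¬Finsupp.single j 1 ≤ e := fun h => by
      have := h j
      rw [Finsupp.single_eq_same, hej] at this
      omega
    rw [if_neg this, Ring.choose_zero_right, Ring.choose_zero_right,
      show a j + 1 - ((0 : ℕ) : ℤ) = 1 + (a j - ((0 : ℕ) : ℤ)) by ring, zpow_add₀ (hg j), zpow_one]
    ring
  · have : Finsupp.single j 1 ≤ e := by
      rw [Finsupp.single_le_iff]
      omega
    rw [if_pos this, Ring.choose_succ_succ, Nat.add_sub_cancel,
      show a j - (c : ℤ) = 1 + (a j - ((c + 1 : ℕ) : ℤ)) by push_cast; ring,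
      show a j + 1 - ((c + 1 : ℕ) : ℤ) = 1 + (a j - ((c + 1 : ℕ) : ℤ)) by push_cast; ring,
      zpow_add₀ (hg j), zpow_one]
    push_cast
    ring

theorem shiftedVariable_pow_mul_binomialSeries (hq : 0 < q) (a : Fin n → ℤ) (j : Fin n) (m : ℕ) :
    shiftedVariable q P j ^ m * binomialSeries q P a =
      binomialSeries q P (Function.update a j (a j + m)) := by
  induction m with
  | zero => simp
  | succ m ih =>
    rw [pow_succ', mul_assoc, ih, shiftedVariable_mul_binomialSeries q P hq]
    congr 1
    rw [Function.update_idem, Function.update_self]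
    push_cast
    ring_nf

theorem prod_shiftedVariable_pow_mul_binomialSeries (hq : 0 < q) (a : Fin n → ℤ) (m : Fin n → ℕ) :
    (∏ i, shiftedVariable q P i ^ m i) * binomialSeries q P a =
      binomialSeries q P fun i => a i + m i := by
  have key : ∀ s : Finset (Fin n), (∏ i ∈ s, shiftedVariable q P i ^ m i) *
      binomialSeries q P a = binomialSeries q P fun i => a i + if i ∈ s then (m i : ℤ) else 0 := by
    intro s
    induction s using Finset.induction_on with
    | empty => simp
    | insert j s hj ih =>
      rw [Finset.prod_insert hj, mul_assoc, ih, shiftedVariable_pow_mul_binomialSeries q P hq]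
      congr 1
      ext i
      by_cases h : i = j
      · subst h
        simp [hj]
      · simp [h]
  simpa using key Finset.univ

theorem prod_shiftedVariable_pow_mul_prod_inv (hq : 0 < q) (m : Fin n → ℕ) :
    (∏ i, shiftedVariable q P i ^ m i) * ∏ i, (shiftedVariable q P i)⁻¹ =
      binomialSeries q P fun i => (m i : ℤ) - 1 := by
  have h1 := prod_shiftedVariable_pow_mul_binomialSeries q P hq (fun _ => -1) (fun _ => 1)
  have h2 : ∏ i, shiftedVariable q P i * (shiftedVariable q P i)⁻¹ = 1 :=
    Finset.prod_eq_one fun i _ => shiftedVariable_mul_inv q P hq i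
  -- Raising all exponents from `-1` to `0` gives `1`, which identifies the inverse.
  have h3 : ∏ i, (shiftedVariable q P i)⁻¹ = binomialSeries q P fun _ => -1 := by
    simp only [pow_one, Nat.cast_one, neg_add_cancel] at h1
    have h0 : binomialSeries q P (fun _ => 0) = 1 := binomialSeries_zero q P
    rw [h0] at h1
    rw [Finset.prod_mul_distrib] at h2
    calc _ = (∏ i, (shiftedVariable q P i)⁻¹) * ((∏ i, shiftedVariable q P i) *
          binomialSeries q P fun _ => -1) := by rw [h1, mul_one]
      _ = ((∏ i, shiftedVariable q P i) * ∏ i, (shiftedVariable q P i)⁻¹) *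
          binomialSeries q P fun _ => -1 := by ring
      _ = _ := by rw [h2, one_mul]
  rw [h3, prod_shiftedVariable_pow_mul_binomialSeries q P hq]
  simp only [neg_add_eq_sub]

/-- The sum of products of Bernoulli polynomials over the box. -/
noncomputable def boxSum (m : Fin n → ℕ) : ℚ :=
  ∑ b ∈ box q P, ∏ i, (Polynomial.bernoulli (m i)).eval ((b i : ℚ) / q)

theorem coeff_coeff_boxSeries (hq : 0 < q) (N : ℕ) (e : Fin n →₀ ℕ) :
    MvPowerSeries.coeff e (PowerSeries.coeff N (boxSeries q P)) =
      (-1) ^ n * ∑ m ∈ Finset.piAntidiag (Finset.univ : Finset (Fin n)) N,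
        algebraMap ℚ (FractionRing ℤ[X])
          ((q : ℚ) ^ ((N : ℤ) - n) * (boxSum q P m / ∏ i, ((m i)! : ℚ))) *
        ∏ i, ((Ring.choose ((m i : ℤ) - 1) (e i) : ℤ) : FractionRing ℤ[X]) *
          genericVector q P i ^ ((m i : ℤ) - 1 - e i) := by
  have hq0 : (q : ℚ) ≠ 0 := by exact_mod_cast hq.ne'
  have h1 : PowerSeries.coeff N (boxSeries q P) =
      ∑ m ∈ Finset.piAntidiag (Finset.univ : Finset (Fin n)) N,
        ((-1) ^ n * ((q : ℚ) ^ ((N : ℤ) - n) * (boxSum q P m / ∏ i, ((m i)! : ℚ)))) •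
          binomialSeries q P fun i => (m i : ℤ) - 1 := by
    rw [boxSeries, map_sum]
    simp only [twistedTodd, coeff_prod_mk]
    rw [Finset.sum_comm]
    refine Finset.sum_congr rfl fun m hm => ?_
    rw [Finset.mem_piAntidiag] at hm
    rw [← prod_shiftedVariable_pow_mul_prod_inv q P hq, boxSum, Finset.sum_div, Finset.mul_sum,
      Finset.mul_sum, Finset.sum_smul]
    refine Finset.sum_congr rfl fun b _ => ?_
    have hfac : ∀ i, ((((m i)! : ℚ)⁻¹ * (Polynomial.bernoulli (m i)).eval ((b i : ℚ) / q)) •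
        -(((q : MvPowerSeries (Fin n) (FractionRing ℤ[X])) * shiftedVariable q P i) ^ m i *
          (algebraMap ℚ _ (q : ℚ)⁻¹ * (shiftedVariable q P i)⁻¹))) =
        algebraMap ℚ _ (-1 * (((m i)! : ℚ)⁻¹ *
          (Polynomial.bernoulli (m i)).eval ((b i : ℚ) / q)) * ((q : ℚ) ^ m i * (q : ℚ)⁻¹)) *
        (shiftedVariable q P i ^ m i * (shiftedVariable q P i)⁻¹) := by
      intro i
      rw [Algebra.smul_def]
      simp only [map_mul, map_neg, map_one, map_pow, map_natCast]
      ring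
    simp only [hfac, Finset.prod_mul_distrib]
    rw [← map_prod, Algebra.smul_def]
    congr 2
    simp only [Finset.prod_mul_distrib, Finset.prod_const, Finset.card_fin,
      Finset.prod_pow_eq_pow_sum, Finset.prod_inv_distrib]
    rw [hm.1, zpow_sub₀ hq0, zpow_natCast, zpow_natCast, inv_pow]
    ring
  rw [h1, map_sum, Finset.mul_sum]
  refine Finset.sum_congr rfl fun m _ => ?_
  rw [Algebra.smul_def, MvPowerSeries.algebraMap_apply, MvPowerSeries.coeff_C_mul,
    coeff_binomialSeries, map_mul, map_pow, map_neg, map_one]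
  ring

end Binomial

/-! ### Evaluating sums over the box -/

section BoxSum

/-- The multiplication theorem at `0`: the numerators form the geometric sum `∑ e^{bu}`, which turns
the denominator `1 - e^{qu}` into `1 - e^u`. -/
theorem sum_bernoulli_eval_div (q : ℕ) (hq : 0 < q) (m : ℕ) :
    ∑ b : Fin q, (Polynomial.bernoulli m).eval ((b : ℚ) / q) =
      (q : ℚ) ^ (1 - (m : ℤ)) * bernoulli m := by
  have hq0 : (q : ℚ) ≠ 0 := by exact_mod_cast hq.ne'
  have h1 : (1 - PowerSeries.rescale (1 : ℚ) (PowerSeries.exp ℚ)) * twistedTodd (1 : ℚ) 1 0 =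
      PowerSeries.X := by
    rw [one_sub_exp_mul_twistedTodd (one_mul 1)]
    have := prod_rescale_exp (∅ : Finset ℕ) fun _ => (0 : ℚ)
    rw [Finset.prod_empty, Finset.sum_empty] at this
    simp only [map_zero, zero_mul]
    rw [← this, mul_one]
  have h2 : (1 - PowerSeries.rescale (q : ℚ) (PowerSeries.exp ℚ)) *
      ∑ b : Fin q, twistedTodd (q : ℚ) (q : ℚ)⁻¹ ((b : ℚ) / q) =
      PowerSeries.X * ∑ b ∈ Finset.range q, PowerSeries.exp ℚ ^ b := by
    rw [Finset.mul_sum, Finset.mul_sum, ← Fin.sum_univ_eq_sum_range]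
    refine Finset.sum_congr rfl fun b _ => ?_
    rw [one_sub_exp_mul_twistedTodd (mul_inv_cancel₀ hq0), PowerSeries.exp_pow_eq_rescale_exp]
    congr 3
    simp [div_mul_cancel₀ _ hq0]
  have h3 := mul_neg_geom_sum (PowerSeries.exp ℚ) q
  rw [PowerSeries.exp_pow_eq_rescale_exp] at h3
  rw [PowerSeries.rescale_one, RingHom.id_apply] at h1
  have hne := one_sub_rescale_exp_ne_zero (mul_inv_cancel₀ hq0)
  have hne' := one_sub_rescale_exp_ne_zero (one_mul (1 : ℚ))
  rw [PowerSeries.rescale_one, RingHom.id_apply] at hne'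
  have h4 : ∑ b : Fin q, twistedTodd (q : ℚ) (q : ℚ)⁻¹ ((b : ℚ) / q) =
      twistedTodd (1 : ℚ) 1 0 := by
    apply mul_left_cancel₀ (mul_ne_zero hne' hne)
    linear_combination (1 - PowerSeries.exp ℚ) * h2 + PowerSeries.X * h3 -
      (1 - PowerSeries.rescale (q : ℚ) (PowerSeries.exp ℚ)) * h1
  have h5 := congrArg (PowerSeries.coeff m) h4
  rw [map_sum] at h5
  simp only [twistedTodd, PowerSeries.coeff_mk, smul_eq_mul, one_pow, mul_one,
    Polynomial.bernoulli_eval_zero] at h5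
  rw [← Finset.sum_mul, ← Finset.mul_sum] at h5
  have hm : ((m ! : ℕ) : ℚ) ≠ 0 := by exact_mod_cast Nat.factorial_ne_zero m
  rw [zpow_sub₀ hq0, zpow_one, zpow_natCast]
  field_simp at h5 ⊢
  linarith

/-- Because `P i₀` is invertible modulo `q`, the coordinate `i₀` of a box point is determined by the
others, which are free. -/
theorem sum_box_eq {k : ℕ} (q : ℕ) (P : Fin (k + 1) → ℕ) (i₀ : Fin (k + 1))
    (hP : (P i₀).Coprime q) (x : (Fin k → Fin q) → Fin q)
    (hx : ∀ a, i₀.insertNth (α := fun _ => Fin q) (x a) a ∈ box q P)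
    (G : (Fin (k + 1) → Fin q) → ℚ) :
    ∑ b ∈ box q P, G b = ∑ a, G (i₀.insertNth (α := fun _ => Fin q) (x a) a) := by
  symm
  refine Finset.sum_bij (fun a _ => i₀.insertNth (α := fun _ => Fin q) (x a) a)
    (fun a _ => hx a) ?_ ?_ (fun _ _ => rfl)
  · intro a _ b _ h
    ext j
    have := congrFun h (i₀.succAbove j)
    simpa using congrArg Fin.val this
  · intro b hb
    refine ⟨fun j => b (i₀.succAbove j), Finset.mem_univ _, ?_⟩
    have h := hx fun j => b (i₀.succAbove j)
    simp only [box, Finset.mem_filter, Finset.mem_univ, true_and] at h hb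
    rw [Fin.sum_univ_succAbove _ i₀] at h hb
    simp only [Fin.insertNth_apply_same, Fin.insertNth_apply_succAbove] at h
    have h' : P i₀ * (x fun j => b (i₀.succAbove j) : Fin q) ≡ P i₀ * b i₀ [MOD q] :=
      Nat.ModEq.add_right_cancel' _ (((Nat.modEq_zero_iff_dvd.2 h).trans
        (Nat.modEq_zero_iff_dvd.2 hb).symm))
    have h'' := Nat.ModEq.cancel_left_of_coprime (by rw [Nat.gcd_comm]; exact hP) h'
    have hval : (x fun j => b (i₀.succAbove j)) = b i₀ := Fin.ext (by
      rwa [Nat.ModEq, Nat.mod_eq_of_lt (Fin.is_lt _), Nat.mod_eq_of_lt (Fin.is_lt _)] at h'')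
    rw [hval]
    exact Fin.insertNth_self_removeNth i₀ b

theorem exists_dvd_mul_add {q a : ℕ} (hq : 0 < q) (ha : a.Coprime q) (c : ℕ) :
    ∃ x : Fin q, q ∣ a * x + c := by
  have : NeZero q := ⟨hq.ne'⟩
  set y : ZMod q := -(((ZMod.unitOfCoprime a ha)⁻¹ : (ZMod q)ˣ) : ZMod q) * c with hy
  refine ⟨⟨y.val, ZMod.val_lt y⟩, ?_⟩
  rw [← ZMod.natCast_eq_zero_iff]
  push_cast
  rw [ZMod.natCast_zmod_val, hy, ← ZMod.coe_unitOfCoprime a ha]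
  linear_combination (-(c : ZMod q)) * Units.mul_inv (ZMod.unitOfCoprime a ha)

/-- As `B₀(x) = 1`, the dependent coordinate may be taken to be `i₀` and drops out; the sum then
factors over the `k` free coordinates. -/
theorem boxSum_eq_of_eq_zero {k : ℕ} (q : ℕ) (hq : 0 < q) (P : Fin (k + 1) → ℕ)
    (hP : ∀ i, (P i).Coprime q) (m : Fin (k + 1) → ℕ) (i₀ : Fin (k + 1)) (hi₀ : m i₀ = 0) :
    boxSum q P m = (q : ℚ) ^ ((k : ℤ) - (∑ i, m i : ℕ)) * ∏ i, bernoulli (m i) := by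
  have hq0 : (q : ℚ) ≠ 0 := by exact_mod_cast hq.ne'
  have hex : ∀ a : Fin k → Fin q, ∃ x : Fin q,
      i₀.insertNth (α := fun _ => Fin q) x a ∈ box q P := by
    intro a
    obtain ⟨x, hx⟩ := exists_dvd_mul_add hq (hP i₀) (∑ j, P (i₀.succAbove j) * (a j : ℕ))
    refine ⟨x, ?_⟩
    simp only [box, Finset.mem_filter, Finset.mem_univ, true_and]
    rw [Fin.sum_univ_succAbove _ i₀]
    simpa only [Fin.insertNth_apply_same, Fin.insertNth_apply_succAbove] using hx
  choose x hx using hex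
  rw [boxSum, sum_box_eq q P i₀ (hP i₀) x hx]
  simp only [Fin.prod_univ_succAbove _ i₀, Fin.sum_univ_succAbove _ i₀, hi₀,
    Fin.insertNth_apply_same, Fin.insertNth_apply_succAbove, Polynomial.bernoulli_zero,
    Polynomial.eval_one, one_mul, bernoulli_zero, zero_add]
  rw [← Fintype.piFinset_univ, ← Finset.prod_univ_sum (fun _ => Finset.univ)
    fun j (b : Fin q) => (Polynomial.bernoulli (m (i₀.succAbove j))).eval ((b : ℚ) / q)]
  simp only [sum_bernoulli_eval_div q hq, Finset.prod_mul_distrib]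
  congr 1
  rw [zpow_sub₀ hq0]
  simp only [zpow_sub₀ hq0, zpow_one, zpow_natCast, Finset.prod_div_distrib, Finset.prod_const,
    Finset.card_fin, Finset.prod_pow_eq_pow_sum]

theorem boxSum_snoc {k : ℕ} (q : ℕ) (hq : 0 < q) (p : Fin k → ℕ) (r : Fin (k + 1) → ℕ) :
    boxSum q (Fin.snoc (α := fun _ => ℕ) p (q - 1)) r = toddCoeff q p r := by
  have hlast : (Fin.snoc (α := fun _ => ℕ) p (q - 1) : Fin (k + 1) → ℕ) (Fin.last k) = q - 1 :=
    Fin.snoc_last _ _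
  have hsucc : ∀ j, (Fin.snoc (α := fun _ => ℕ) p (q - 1) : Fin (k + 1) → ℕ) (Fin.castSucc j) =
    p j := fun j => Fin.snoc_castSucc _ _ _
  rw [boxSum, sum_box_eq q _ (Fin.last k) ?_
    (fun a => ⟨(∑ i, p i * (a i : ℕ)) % q, Nat.mod_lt _ hq⟩) ?_, toddCoeff]
  · refine Finset.sum_congr rfl fun a _ => ?_
    rw [Fin.prod_univ_castSucc]
    simp only [Fin.insertNth_last', Fin.snoc_castSucc, Fin.snoc_last]
    congr 2
    have := Int.fract_div_natCast_eq_div_natCast_mod (k := ℚ) (m := ∑ i, p i * (a i : ℕ)) (n := q)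
    rw [← this]
    push_cast
    rfl
  · rw [hlast]
    exact (Nat.coprime_self_sub_left hq).2 (Nat.coprime_one_left q)
  · intro a
    simp only [box, Finset.mem_filter, Finset.mem_univ, true_and, Fin.insertNth_last']
    rw [Fin.sum_univ_castSucc]
    simp only [Fin.snoc_castSucc, Fin.snoc_last]
    set s := ∑ i, p i * (a i : ℕ)
    have h : s + (q - 1) * (s % q) ≡ s + (q - 1) * s [MOD q] :=
      ((Nat.mod_modEq s q).mul_left _).add_left _
    refine (Nat.modEq_zero_iff_dvd.1 (h.trans (Nat.modEq_zero_iff_dvd.2 ⟨s, ?_⟩)))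
    obtain ⟨c, rfl⟩ : ∃ c, q = c + 1 := ⟨q - 1, by omega⟩
    simp only [Nat.add_sub_cancel]
    ring

end BoxSum

/-! ### Reduction modulo `q` -/

section Residue

open Polynomial

/-- An integer divisible by `q` in the Gauss ring is divisible by `q` in `ℤ`; hence `ZMod q` embeds
in the quotient and congruences can be checked there. -/
instance charP_gaussSubring_quotient (q : ℕ) :
    CharP (gaussSubring ⧸ Ideal.span {(q : gaussSubring)}) q where
  cast_eq_zero_iff x := by
    rw [← map_natCast (Ideal.Quotient.mk (Ideal.span {(q : gaussSubring)})),
      Ideal.Quotient.eq_zero_iff_mem, Ideal.mem_span_singleton]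
    constructor
    · rintro ⟨w, hw⟩
      have := congrArg (fun y : gaussSubring => (y : FractionRing ℤ[X])) hw
      have h := dvd_of_eq_mul_of_mem_gaussSubring (a := x) (b := q) w.2 (by simpa using this)
      exact_mod_cast h
    · rintro ⟨c, rfl⟩
      exact ⟨c, by push_cast; rfl⟩

theorem exists_int_of_mem_gaussSubring {A : ℚ}
    (hA : algebraMap ℚ (FractionRing ℤ[X]) A ∈ gaussSubring) : ∃ a : ℤ, (a : ℚ) = A := by
  have h : (A.num : FractionRing ℤ[X]) = (A.den : ℤ) * algebraMap ℚ (FractionRing ℤ[X]) A := by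
    rw [Int.cast_natCast, ← map_natCast (algebraMap ℚ (FractionRing ℤ[X])), ← map_mul,
      Rat.den_mul_eq_num, map_intCast]
  have h1 := dvd_of_eq_mul_of_mem_gaussSubring hA h
  have h2 : A.den = 1 := by
    have := Int.natAbs_dvd_natAbs.2 h1
    rw [Int.natAbs_natCast] at this
    exact Nat.dvd_one.1 (A.reduced.gcd_eq_one ▸ Nat.dvd_gcd this dvd_rfl)
  exact ⟨A.num, by rw [← Rat.den_mul_eq_num, h2]; simp⟩

variable {n : ℕ} (q : ℕ) (P : Fin n → ℕ)

theorem algebraMap_ne_zero_of_isPrimitive {f : ℤ[X]} (hf : f.IsPrimitive) :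
    algebraMap ℤ[X] (FractionRing ℤ[X]) f ≠ 0 := by
  simpa using hf.ne_zero

/-- The multiple by `q` of a coordinate of the generic vector, as a unit of `gaussSubring`. -/
noncomputable def genericUnit (hP : ∀ i, (P i).Coprime q) (i : Fin n) : gaussSubringˣ where
  val := ⟨_, algebraMap_mem_gaussSubring (C (P i : ℤ) + C (q : ℤ) * X ^ ((i : ℕ) + 1))⟩
  inv := ⟨_, inv_algebraMap_mem_gaussSubring (isPrimitive_C_add_C_mul_X_pow (hP i) i)⟩
  val_inv := Subtype.ext (mul_inv_cancel₀
    (algebraMap_ne_zero_of_isPrimitive (isPrimitive_C_add_C_mul_X_pow (hP i) i)))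
  inv_val := Subtype.ext (inv_mul_cancel₀
    (algebraMap_ne_zero_of_isPrimitive (isPrimitive_C_add_C_mul_X_pow (hP i) i)))

theorem coe_genericUnit (hP : ∀ i, (P i).Coprime q) (i : Fin n) :
    ((genericUnit q P hP i : gaussSubring) : FractionRing ℤ[X]) =
      algebraMap ℤ[X] _ (C (P i : ℤ) + C (q : ℤ) * X ^ ((i : ℕ) + 1)) := rfl

theorem coe_genericUnit_zpow (hP : ∀ i, (P i).Coprime q) (i : Fin n) (z : ℤ) :
    (((genericUnit q P hP i ^ z : gaussSubringˣ) : gaussSubring) : FractionRing ℤ[X]) =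
      ((genericUnit q P hP i : gaussSubring) : FractionRing ℤ[X]) ^ z := by
  have h := Units.val_zpow_eq_zpow_val
    (Units.map (gaussSubring.subtype : _ →* FractionRing ℤ[X]) (genericUnit q P hP i)) z
  rw [← map_zpow] at h
  exact h

theorem mk_genericUnit (hP : ∀ i, (P i).Coprime q) (i : Fin n) :
    Ideal.Quotient.mk (Ideal.span {(q : gaussSubring)}) (genericUnit q P hP i) =
      ((P i : ℕ) : gaussSubring ⧸ Ideal.span {(q : gaussSubring)}) := by
  rw [← map_natCast (Ideal.Quotient.mk _), Ideal.Quotient.eq, Ideal.mem_span_singleton]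
  refine ⟨⟨_, algebraMap_mem_gaussSubring (X ^ ((i : ℕ) + 1))⟩, Subtype.ext ?_⟩
  simp [coe_genericUnit]

theorem mk_genericUnit_zpow (hP : ∀ i, (P i).Coprime q) (u : Fin n → (ZMod q)ˣ)
    (hu : ∀ i, (u i : ZMod q) = (P i : ZMod q)) (i : Fin n) (z : ℤ) :
    Ideal.Quotient.mk (Ideal.span {(q : gaussSubring)})
        ((genericUnit q P hP i ^ z : gaussSubringˣ) : gaussSubring) =
      ZMod.castHom (dvd_refl q) (gaussSubring ⧸ Ideal.span {(q : gaussSubring)})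
        ((u i ^ z : (ZMod q)ˣ) : ZMod q) := by
  have h : Units.map (Ideal.Quotient.mk (Ideal.span {(q : gaussSubring)}) : _ →* _)
      (genericUnit q P hP i) =
      Units.map (ZMod.castHom (dvd_refl q) (gaussSubring ⧸ Ideal.span {(q : gaussSubring)})
          ).toMonoidHom (u i) := by
    apply Units.ext
    rw [Units.coe_map, Units.coe_map]
    change Ideal.Quotient.mk _ _ = ZMod.castHom _ _ _
    rw [mk_genericUnit, hu, map_natCast]
  have h' := congrArg (fun x => ((x ^ z : (_)ˣ) : _ ⧸ Ideal.span {(q : gaussSubring)})) h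
  simp only [← map_zpow] at h'
  exact h'

/-- The coordinates `gᵢ` are not integral, but `q gᵢ` is a unit; exponents with sum zero cancel the
powers of `q`. -/
theorem prod_genericVector_zpow (hq : 0 < q) (hP : ∀ i, (P i).Coprime q) (z : Fin n → ℤ)
    (hz : ∑ i, z i = 0) :
    ∏ i, genericVector q P i ^ z i =
      ∏ i, (((genericUnit q P hP i ^ z i : gaussSubringˣ) : gaussSubring) :
        FractionRing ℤ[X]) := by
  have hq' : (q : FractionRing ℤ[X]) ≠ 0 := by exact_mod_cast hq.ne'
  simp only [coe_genericUnit_zpow, coe_genericUnit, genericVector, mul_zpow,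
    Finset.prod_mul_distrib]
  have : ∀ s : Finset (Fin n), ∏ i ∈ s, (q : FractionRing ℤ[X])⁻¹ ^ z i =
      (q : FractionRing ℤ[X])⁻¹ ^ ∑ i ∈ s, z i := by
    intro s
    induction s using Finset.induction_on with
    | empty => simp
    | insert a s ha ih =>
      rw [Finset.prod_insert ha, Finset.sum_insert ha, zpow_add₀ (inv_ne_zero hq'), ih]
  rw [this, hz, zpow_zero, one_mul]

end Residue

/-! ### Extracting the coefficient and the congruence -/

section Main

open Polynomial

/-- Some `m i` is below `r i`, and `m i - 1 ≥ 0` kills the binomial. If `m i = 0` the upper index is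
`-1` and the binomial is `±1`, so those indices survive. -/
theorem prod_choose_eq_zero {n : ℕ} {m r : Fin n → ℕ} (hsum : ∑ i, m i = ∑ i, r i)
    (hne : m ≠ r) (hm : ∀ i, m i ≠ 0) :
    ∃ i, Ring.choose ((m i : ℤ) - 1) (r i - 1) = 0 := by
  obtain ⟨i, hi⟩ : ∃ i, m i < r i := by
    by_contra hcon
    push Not at hcon
    refine hne (funext fun i => ?_)
    exact ((Finset.sum_eq_sum_iff_of_le fun i _ => hcon i).1 hsum.symm i (Finset.mem_univ i)).symm
  refine ⟨i, ?_⟩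
  have := hm i
  rw [show (m i : ℤ) - 1 = ((m i - 1 : ℕ) : ℤ) by omega, Ring.choose_natCast,
    Nat.choose_eq_zero_of_lt (by omega), Nat.cast_zero]

theorem q_mul_coeff_boxSeries {k : ℕ} (q : ℕ) (hq : 0 < q) (P : Fin (k + 1) → ℕ)
    (hP : ∀ i, (P i).Coprime q) (r : Fin (k + 1) → ℕ) (hr : ∀ i, 1 ≤ r i) (N : ℕ)
    (hN : N = ∑ i, r i) :
    (-1) ^ (k + 1) * ((q : FractionRing ℤ[X]) * MvPowerSeries.coeff
        (Finsupp.equivFunOnFinite.symm fun i => r i - 1)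
        (PowerSeries.coeff N (boxSeries q P))) =
      algebraMap ℚ _ ((q : ℚ) ^ ((N : ℤ) - ((k + 1 : ℕ) : ℤ) + 1) *
        (boxSum q P r / ∏ i, ((r i)! : ℚ))) +
      ∑ m ∈ (Finset.piAntidiag (Finset.univ : Finset (Fin (k + 1))) N).filter
          (fun m => ∃ i, m i = 0),
        algebraMap ℚ _ (bernoulliQuot m) *
          ∏ i, ((Ring.choose ((m i : ℤ) - 1) (r i - 1) : ℤ) : FractionRing ℤ[X]) *
            genericVector q P i ^ ((m i : ℤ) - (r i : ℤ)) := by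
  have hq0 : (q : ℚ) ≠ 0 := by exact_mod_cast hq.ne'
  rw [coeff_coeff_boxSeries q P hq, ← map_natCast (algebraMap ℚ (FractionRing ℤ[X]))]
  have hexp : ∀ (m : Fin (k + 1) → ℕ) i, (m i : ℤ) - 1 - (r i - 1 : ℕ) = (m i : ℤ) - r i :=
    fun m i => by have := hr i; omega
  have hcalc : ∀ S : FractionRing ℤ[X], (-1 : FractionRing ℤ[X]) ^ (k + 1) *
      (algebraMap ℚ _ (q : ℚ) * ((-1) ^ (k + 1) * S)) = algebraMap ℚ _ (q : ℚ) * S := fun S => by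
    have : ((-1 : FractionRing ℤ[X]) ^ (k + 1)) * (-1) ^ (k + 1) = 1 := by
      rw [← mul_pow]; simp
    linear_combination (algebraMap ℚ _ (q : ℚ) * S) * this
  rw [hcalc, Finset.mul_sum]
  simp only [Finsupp.equivFunOnFinite_symm_apply_apply, hexp]
  rw [← Finset.sum_filter_not_add_sum_filter _ (fun m => ∃ i, m i = 0)]
  congr 1
  · rw [Finset.sum_eq_single r]
    · have h1 : ∀ i, ((Ring.choose ((r i : ℤ) - 1) (r i - 1) : ℤ) : FractionRing ℤ[X]) *
          genericVector q P i ^ ((r i : ℤ) - (r i : ℤ)) = 1 := fun i => by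
        have := hr i
        rw [show (r i : ℤ) - 1 = ((r i - 1 : ℕ) : ℤ) by omega, Ring.choose_natCast,
          Nat.choose_self]
        simp
      rw [Finset.prod_congr rfl fun i _ => h1 i, Finset.prod_const_one, mul_one, ← map_mul,
        zpow_add₀ hq0, zpow_one]
      congr 1
      ring
    · intro m hm hne
      rw [Finset.mem_filter, Finset.mem_piAntidiag] at hm
      obtain ⟨i, hi⟩ := prod_choose_eq_zero (hm.1.1.trans hN) hne (by simpa using hm.2)
      have h0 : ((Ring.choose ((m i : ℤ) - 1) (r i - 1) : ℤ) : FractionRing ℤ[X]) *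
          genericVector q P i ^ ((m i : ℤ) - (r i : ℤ)) = 0 := by
        rw [hi, Int.cast_zero, zero_mul]
      exact mul_eq_zero_of_right _ (mul_eq_zero_of_right _
        (Finset.prod_eq_zero (Finset.mem_univ i) h0))
    · intro h
      refine absurd ?_ h
      rw [Finset.mem_filter, Finset.mem_piAntidiag]
      refine ⟨⟨hN.symm, fun i _ => Finset.mem_univ i⟩, ?_⟩
      rintro ⟨i, hi⟩
      have := hr i
      omega
  · refine Finset.sum_congr rfl fun m hm => ?_
    rw [Finset.mem_filter, Finset.mem_piAntidiag] at hm
    obtain ⟨⟨hmN, -⟩, i₀, hi₀⟩ := hm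
    rw [← mul_assoc, ← map_mul, boxSum_eq_of_eq_zero q hq P hP m i₀ hi₀, hmN, bernoulliQuot,
      Finset.prod_div_distrib]
    congr 2
    -- The extra factor `q` is exactly what balances the box sum, which has `k` free coordinates
    -- instead of `k + 1`.
    have : (q : ℚ) * (q : ℚ) ^ ((N : ℤ) - ((k + 1 : ℕ) : ℤ)) * (q : ℚ) ^ ((k : ℤ) - N) = 1 := by
      rw [← zpow_one_add₀ hq0, ← zpow_add₀ hq0]
      push_cast
      ring_nf
      exact zpow_zero _
    linear_combination ((∏ i, bernoulli (m i)) / ∏ i, ((m i)! : ℚ)) * this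

theorem coprime_snoc {k q : ℕ} (hq : 0 < q) {p : Fin k → ℕ} (hp : ∀ i, (p i).Coprime q)
    (i : Fin (k + 1)) : (Fin.snoc (α := fun _ => ℕ) p (q - 1) i).Coprime q := by
  induction i using Fin.lastCases with
  | last =>
    rw [Fin.snoc_last]
    exact (Nat.coprime_self_sub_left hq).2 (Nat.coprime_one_left q)
  | cast i =>
    rw [Fin.snoc_castSucc]
    exact hp i

theorem coe_unitsOf {k q : ℕ} (hq : 0 < q) {p : Fin k → ℕ} (hp : ∀ i, (p i).Coprime q)
    (i : Fin (k + 1)) :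
    (unitsOf q p hp i : ZMod q) = ((Fin.snoc (α := fun _ => ℕ) p (q - 1) i : ℕ) : ZMod q) := by
  induction i using Fin.lastCases with
  | last =>
    rw [unitsOf, Fin.snoc_last, Fin.snoc_last]
    simp [Nat.cast_sub hq]
  | cast i =>
    rw [unitsOf, Fin.snoc_castSucc, Fin.snoc_castSucc, ZMod.coe_unitOfCoprime]

/-- The scaled Todd coefficients are integers, and their residues modulo `q`. -/
theorem exists_int_eq_toddCoeff (k : ℕ) (q : ℕ) (hq : 0 < q) (p : Fin k → ℕ)
    (hp : ∀ i, (p i).Coprime q)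
    (r : Fin (k + 1) → ℕ) (hr : ∀ i, 1 ≤ r i)
    (N : ℕ) (hN : N = ∑ i, r i) :
    ∃ A : ℤ,
      (A : ℚ) = (toddDenom N (k + 1) : ℚ)
        * (q : ℚ) ^ ((N : ℤ) - ((k + 1 : ℕ) : ℤ) + 1)
        / (∏ i, ((r i).factorial : ℚ)) * toddCoeff q p r ∧
      (A : ZMod q) =
        ∑ m ∈ (Finset.piAntidiag (Finset.univ : Finset (Fin (k + 1))) N).filter
            (fun m => ∃ i, m i = 0),
          -(scaledBernoulli m : ZMod q) *
            ∏ i, ((Ring.choose ((m i : ℤ) - 1) (r i - 1) : ℤ) : ZMod q) *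
              (((unitsOf q p hp i) ^ ((m i : ℤ) - (r i : ℤ)) : (ZMod q)ˣ) :
                ZMod q) := by
  set P : Fin (k + 1) → ℕ := Fin.snoc (α := fun _ => ℕ) p (q - 1) with hPdef
  have hP : ∀ i, (P i).Coprime q := coprime_snoc hq hp
  set d := toddDenom N (k + 1) with hd
  set e : Fin (k + 1) →₀ ℕ := Finsupp.equivFunOnFinite.symm fun i => r i - 1 with he
  have hint := coeff_mem_of_mem_integralSeries
    (toddDenom_smul_coeff_mem N q P hq (realizes_indicator_weight q P hq)) e
  set w : gaussSubring := (-1) ^ (k + 1) * ⟨_, hint⟩ with hw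
  set S : gaussSubring := ∑ m ∈ (Finset.piAntidiag (Finset.univ : Finset (Fin (k + 1))) N).filter
      (fun m => ∃ i, m i = 0), (scaledBernoulli m : gaussSubring) *
        ∏ i, ((Ring.choose ((m i : ℤ) - 1) (r i - 1) : ℤ) : gaussSubring) *
          ((genericUnit q P hP i ^ ((m i : ℤ) - (r i : ℤ)) : gaussSubringˣ) : gaussSubring) with hS
  have hkey := q_mul_coeff_boxSeries q hq P hP r hr N hN
  rw [boxSum_snoc q hq p r, ← he] at hkey
  set A : ℚ := (d : ℚ) * (q : ℚ) ^ ((N : ℤ) - ((k + 1 : ℕ) : ℤ) + 1)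
        / (∏ i, ((r i).factorial : ℚ)) * toddCoeff q p r with hA
  have hSF : (S : FractionRing ℤ[X]) = (d : FractionRing ℤ[X]) *
      ∑ m ∈ (Finset.piAntidiag (Finset.univ : Finset (Fin (k + 1))) N).filter
          (fun m => ∃ i, m i = 0),
        algebraMap ℚ _ (bernoulliQuot m) *
          ∏ i, ((Ring.choose ((m i : ℤ) - 1) (r i - 1) : ℤ) : FractionRing ℤ[X]) *
            genericVector q P i ^ ((m i : ℤ) - (r i : ℤ)) := by
    rw [hS, Finset.mul_sum]
    push_cast
    refine Finset.sum_congr rfl fun m hm => ?_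
    rw [Finset.mem_filter, Finset.mem_piAntidiag] at hm
    have h1 : (scaledBernoulli m : FractionRing ℤ[X]) =
        d * algebraMap ℚ (FractionRing ℤ[X]) (bernoulliQuot m) := by
      rw [← map_intCast (algebraMap ℚ (FractionRing ℤ[X])), cast_scaledBernoulli, hm.1.1, map_mul,
        map_natCast]
    rw [Finset.prod_mul_distrib, Finset.prod_mul_distrib,
      prod_genericVector_zpow q P hq hP (fun i => (m i : ℤ) - r i) ?_, h1, mul_assoc]
    rw [Finset.sum_sub_distrib, sub_eq_zero]
    exact_mod_cast hm.1.1.trans hN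
  have hAF : algebraMap ℚ (FractionRing ℤ[X]) A = ((q * w - S : gaussSubring) :
      FractionRing ℤ[X]) := by
    have hwF : (w : FractionRing ℤ[X]) = (-1) ^ (k + 1) * (d * MvPowerSeries.coeff e
        (PowerSeries.coeff N (boxSeries q P))) := by
      rw [hw]
      push_cast
      rw [Algebra.smul_def, MvPowerSeries.algebraMap_apply, MvPowerSeries.coeff_C_mul,
        map_natCast]
    have hA' : algebraMap ℚ (FractionRing ℤ[X]) A = d * algebraMap ℚ (FractionRing ℤ[X])
        ((q : ℚ) ^ ((N : ℤ) - ((k + 1 : ℕ) : ℤ) + 1) *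
          (toddCoeff q p r / ∏ i, ((r i)! : ℚ))) := by
      rw [← map_natCast (algebraMap ℚ (FractionRing ℤ[X])), ← map_mul, hA]
      congr 1
      ring
    push_cast
    rw [hwF, hSF, hA']
    linear_combination (-(d : FractionRing ℤ[X])) * hkey
  -- The value is rational and equals `q w - S` in the Gauss ring, hence is an integer.
  obtain ⟨a, ha⟩ := exists_int_of_mem_gaussSubring (A := A) (by rw [hAF]; exact Subtype.prop _)
  refine ⟨a, ha, ?_⟩
  apply ZMod.castHom_injective (gaussSubring ⧸ Ideal.span {(q : gaussSubring)}) (n := q)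
  have haW : (a : gaussSubring) = q * w - S := by
    apply Subtype.ext
    rw [← hAF, ← ha, map_intCast]
    push_cast
    rfl
  have hmk := congrArg (Ideal.Quotient.mk (Ideal.span {(q : gaussSubring)})) haW
  have hq_mk : Ideal.Quotient.mk (Ideal.span {(q : gaussSubring)}) (q : gaussSubring) = 0 :=
    Ideal.Quotient.eq_zero_iff_mem.2 (Ideal.mem_span_singleton_self _)
  rw [map_sub, map_mul, hq_mk, zero_mul, zero_sub, map_intCast] at hmk
  rw [map_intCast, hmk, hS]
  simp only [map_sum, map_mul, map_prod, map_neg, map_intCast, neg_mul, Finset.sum_neg_distrib,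
    mk_genericUnit_zpow q P hP (unitsOf q p hp) (coe_unitsOf hq hp)]

end Main

end ToddCongruence

theorem mainTheorem5 (k : ℕ) (q : ℕ) (hq : 0 < q) (p : Fin k → ℕ)
    (hp0 : ∀ i, 0 < p i) (hpq : ∀ i, p i < q) (hp : ∀ i, (p i).Coprime q)
    (r : Fin (k + 1) → ℕ) (hr : ∀ i, 1 ≤ r i)
    (N : ℕ) (hN : N = ∑ i, r i) :
    ∃ A : ℤ,
      (A : ℚ) = (ToddCongruence.toddDenom N (k + 1) : ℚ)
        * (q : ℚ) ^ ((N : ℤ) - ((k + 1 : ℕ) : ℤ) + 1)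
        / (∏ i, ((r i).factorial : ℚ)) * ToddCongruence.toddCoeff q p r ∧
      (A : ZMod q) =
        ∑ m ∈ (Finset.piAntidiag (Finset.univ : Finset (Fin (k + 1))) N).filter
            (fun m => ∃ i, m i = 0),
          -(ToddCongruence.scaledBernoulli m : ZMod q) *
            ∏ i, ((Ring.choose ((m i : ℤ) - 1) (r i - 1) : ℤ) : ZMod q) *
              (((ToddCongruence.unitsOf q p hp i) ^ ((m i : ℤ) - (r i : ℤ)) : (ZMod q)ˣ) :
                ZMod q) := by
  exact ToddCongruence.exists_int_eq_toddCoeff k q hq p hp r hr N hN
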